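/- All functions and polynomials are real valued, $\mathrm{Pol}_d(\mathbb R^n)$ is the space of polynomials of total degree at most $d$, and $\|\cdot\|_K$ is the sup norm on $K$. **Spaces.** Let $K\subset\mathbb R^n$ be a fat compact set, i.e. $K=\overline{\operatorname{int}K}$. For $m\in\mathbb N\cup\{\infty\}$, $C^m(K)$ is the space of functions on $K$ that are $m$ times continuously differentiable on the interior of $K$ and all of whose derivatives of order $\le m$ extend continuously to $K$; it carries the topology defined by the seminorms $\|D^\alpha f\|_K$, $|\alpha|\le m$. **Conditions on compact sets.** - $K$ is a $\theta$-SBM compact set ($\theta>0$) if there are a probability measure $\mu$ on $K$ and a constant $C$ such that $\|p\|_K\le C(\deg p)^\theta\big(\int_K p^2\,d\mu\big)^{1/2}$ for all nonconstant polynomials $p$. - $K$ satisfies a Markov inequality of exponent $r$ if there is a constant $M>0$ such that $\|D^\alpha p\|_K\le M(\deg p)^{r|\alpha|}\|p\|_K$ for all $\alpha\in\mathbb N^n$ and all polynomials $p$. - $K$ is a Jackson compact set if for every $m\in\mathbb N$ and $f\in C^m(K)$ there is a constant $M$ such that $\inf\{\|f-p\|_K : p\in\mathrm{Pol}_d(\mathbb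 R^n)\}\le M d^{-m}$ for all $d\ge1$. **Newton sequences.** A polynomial projector of degree $d$ on $C^\infty(K)$ is a continuous linear map $\Pi:C^\infty(K)\to C^\infty(K)$ with values in $\mathrm{Pol}_d(\mathbb R^n)$ that is the identity on $\mathrm{Pol}_d(\mathbb R^n)$. Its space of interpolation conditions is $\mathcal I(\Pi)=\{\nu\in C^\infty(K)' : \nu(f)=\nu(\Pi f)\ \text{for all } f\in C^\infty(K)\}$. A Newton sequence on $C^\infty(K)$ is a sequence $\mathcal N=(\Pi_0,\Pi_1,\dots)$ in which $\Pi_d$ is a polynomial projector of degree $d$ on $C^\infty(K)$ and $\mathcal I(\Pi_d)\subset\mathcal I(\Pi_{d+1})$ for all $d$. It converges on $C^\infty(K)$ if $\Pi_d f\to f$ in $C^\infty(K)$ for every $f\in C^\infty(K)$. **Newton product.** Let $\mathcal N^s=(\Pi^s_d)_{d\ge0}$ be a Newton sequence on $C^\infty(K_s)$, $s=1,2$. A Newton product of $\mathcal N^1$ by $\mathcal N^2$ is a Newton sequence $(\Pi_d)_{d\ge0}$ on $C^\infty(K_1\times K_2)$ such that, for all $d$, $$\mathcal I(\Pi_d)=\operatorname{span}\{\mu\otimes\nu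 : \mu\in\mathcal I(\Pi^1_i),\ \nu\in\mathcal I(\Pi^2_j),\ i+j\le d\},$$ where $\mu\otimes\nu$ is the continuous linear form on $C^\infty(K_1\times K_2)$ with $(\mu\otimes\nu)(f_1f_2)=\mu(f_1)\nu(f_2)$ for all product functions $(f_1f_2)(x,y)=f_1(x)f_2(y)$, $f_s\in C^\infty(K_s)$. **Statement.** For $s=1,2$ let $K_s\subset\mathbb R^{n_s}$ be a fat compact set that is a $\theta_s$-SBM compact set and satisfies a Markov inequality of exponent $r_s$, and suppose that $K_1\times K_2$ is a Jackson compact set in $\mathbb R^{n_1+n_2}$. Let $\mathcal N^s$ be a Newton sequence on $C^\infty(K_s)$ that converges on $C^\infty(K_s)$, $s=1,2$. Then there is exactly one Newton product $\mathcal N^1\boxtimes\mathcal N^2$ of $\mathcal N^1$ by $\mathcal N^2$, and it converges on $C^\infty(K_1\times K_2)$. -/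

import Mathlib

open TopologicalSpace Filter Topology MeasureTheory
open scoped ContDiff

noncomputable section

namespace NewtonProduct

set_option linter.unusedSectionVars false

variable {ι : Type*} [Fintype ι] [DecidableEq ι]

/-- The function `K → ℝ` extended by zero to the whole space. Only its values on `K` matter. -/
def extendZero (K : Compacts (ι → ℝ)) (f : C(K, ℝ)) : (ι → ℝ) → ℝ :=
  Function.extend Subtype.val f 0

/-- The iterated partial derivative `∂_{i₁} ∂_{i₂} ⋯ ∂_{iₖ} f` for the word `[i₁, …, iₖ]`.
For smooth functions the order of the letters is irrelevant, so that these are exactly the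
derivatives `D^α f` with `|α| = k`, where `α i` is the number of occurrences of `i`. -/
def iterPartial : List ι → ((ι → ℝ) → ℝ) → ((ι → ℝ) → ℝ)
  | [], f => f
  | i :: w, f => fun x => fderiv ℝ (iterPartial w f) x (Pi.single i 1)

lemma contDiffOn_iterPartial {U : Set (ι → ℝ)} (hU : IsOpen U) {f : (ι → ℝ) → ℝ} :
    ∀ (w : List ι) {m : ℕ∞} (n : ℕ∞), n + w.length ≤ m →
      ContDiffOn ℝ m f U → ContDiffOn ℝ n (iterPartial w f) U
  | [], m, n, h, hf => hf.of_le (by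
      have : n ≤ m := by simpa using h
      exact_mod_cast this)
  | i :: w, m, n, h, hf => by
      have h1 : (n + 1) + w.length ≤ m := by
        refine le_trans (le_of_eq ?_) h
        simp only [List.length_cons, Nat.cast_add, Nat.cast_one]
        rw [add_assoc, add_comm (1 : ℕ∞)]
      have h2 := contDiffOn_iterPartial hU w (n + 1) h1 hf
      have h3 : ContDiffOn ℝ n (fderiv ℝ (iterPartial w f)) U :=
        h2.fderiv_of_isOpen hU (by exact_mod_cast le_refl _)
      exact h3.clm_apply contDiffOn_const

lemma differentiableAt_iterPartial {U : Set (ι → ℝ)} (hU : IsOpen U) {f : (ι → ℝ) → ℝ}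
    {m : ℕ∞} (hf : ContDiffOn ℝ m f U) (w : List ι) (hw : (w.length : ℕ∞) + 1 ≤ m)
    {x : ι → ℝ} (hx : x ∈ U) : DifferentiableAt ℝ (iterPartial w f) x := by
  have h := contDiffOn_iterPartial hU w 1 (by rwa [add_comm]) hf
  exact ((h.differentiableOn (by simp)) x hx).differentiableAt (hU.mem_nhds hx)

lemma iterPartial_add {U : Set (ι → ℝ)} (hU : IsOpen U) {f g : (ι → ℝ) → ℝ} {m : ℕ∞}
    (hf : ContDiffOn ℝ m f U) (hg : ContDiffOn ℝ m g U) :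
    ∀ (w : List ι), (w.length : ℕ∞) ≤ m → ∀ x ∈ U,
      iterPartial w (f + g) x = iterPartial w f x + iterPartial w g x
  | [], _, _, _ => rfl
  | i :: w, hw, x, hx => by
      have hw1 : (w.length : ℕ∞) + 1 ≤ m := by simpa using hw
      have hw0 : (w.length : ℕ∞) ≤ m := le_trans (by simp) hw1
      have heq : iterPartial w (f + g) =ᶠ[𝓝 x] iterPartial w f + iterPartial w g := by
        filter_upwards [hU.mem_nhds hx] with y hy
        exact iterPartial_add hU hf hg w hw0 y hy
      simp only [iterPartial]
      rw [heq.fderiv_eq, fderiv_add (differentiableAt_iterPartial hU hf w hw1 hx)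
        (differentiableAt_iterPartial hU hg w hw1 hx)]
      rfl

lemma iterPartial_smul {U : Set (ι → ℝ)} (hU : IsOpen U) {f : (ι → ℝ) → ℝ} {m : ℕ∞} (c : ℝ)
    (hf : ContDiffOn ℝ m f U) :
    ∀ (w : List ι), (w.length : ℕ∞) ≤ m → ∀ x ∈ U,
      iterPartial w (c • f) x = c * iterPartial w f x
  | [], _, _, _ => rfl
  | i :: w, hw, x, hx => by
      have hw1 : (w.length : ℕ∞) + 1 ≤ m := by simpa using hw
      have hw0 : (w.length : ℕ∞) ≤ m := le_trans (by simp) hw1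
      have heq : iterPartial w (c • f) =ᶠ[𝓝 x] c • iterPartial w f := by
        filter_upwards [hU.mem_nhds hx] with y hy
        exact iterPartial_smul hU c hf w hw0 y hy
      simp only [iterPartial]
      rw [heq.fderiv_eq, fderiv_const_smul (differentiableAt_iterPartial hU hf w hw1 hx)]
      rfl

lemma iterPartial_zero : ∀ (w : List ι), iterPartial w (0 : (ι → ℝ) → ℝ) = 0
  | [] => rfl
  | i :: w => by
      funext x
      simp only [iterPartial, iterPartial_zero w]
      simp

lemma extendZero_add (K : Compacts (ι → ℝ)) (f g : C(K, ℝ)) :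
    extendZero K (f + g) = extendZero K f + extendZero K g := by
  funext x
  by_cases hx : ∃ y : K, (y : ι → ℝ) = x
  · obtain ⟨y, rfl⟩ := hx
    simp [extendZero]
  · simp [extendZero, Function.extend_apply' _ _ _ hx]

lemma extendZero_zero (K : Compacts (ι → ℝ)) : extendZero K 0 = 0 := by
  funext x
  by_cases hx : ∃ y : K, (y : ι → ℝ) = x
  · obtain ⟨y, rfl⟩ := hx
    simp [extendZero]
  · simp [extendZero, Function.extend_apply' _ _ _ hx]

lemma extendZero_smul (K : Compacts (ι → ℝ)) (c : ℝ) (f : C(K, ℝ)) :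
    extendZero K (c • f) = c • extendZero K f := by
  funext x
  by_cases hx : ∃ y : K, (y : ι → ℝ) = x
  · obtain ⟨y, rfl⟩ := hx
    simp [extendZero]
  · simp [extendZero, Function.extend_apply' _ _ _ hx]

/-- The space `C^m(K)`, `m ∈ ℕ ∪ {∞}`, of the functions on `K` that are `m` times continuously
differentiable on the interior of `K` and all of whose derivatives of order `≤ m` extend
continuously to `K`. An element is stored as the family of the continuous extensions of its
derivatives, the function itself being the member for the empty word; when `K` is the closure of
its interior the family is determined by the function. As a subspace of a product of spaces
`C(K, ℝ)` it carries the topology defined by the seminorms `f ↦ sup_K |D^α f|`, `|α| ≤ m`. -/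
def CSpace (m : ℕ∞) (K : Compacts (ι → ℝ)) :
    Submodule ℝ ({w : List ι // (w.length : ℕ∞) ≤ m} → C(K, ℝ)) where
  carrier := {g |
    ContDiffOn ℝ m (extendZero K (g ⟨[], by simp⟩)) (interior (K : Set (ι → ℝ))) ∧
    ∀ w, ∀ x : K, (x : ι → ℝ) ∈ interior (K : Set (ι → ℝ)) →
      g w x = iterPartial w.1 (extendZero K (g ⟨[], by simp⟩)) x}
  add_mem' := by
    rintro f g ⟨hf, hf'⟩ ⟨hg, hg'⟩
    have hext : extendZero K ((f + g) ⟨[], by simp⟩) =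
        extendZero K (f ⟨[], by simp⟩) + extendZero K (g ⟨[], by simp⟩) :=
      extendZero_add K _ _
    refine ⟨?_, fun w x hx => ?_⟩
    · rw [hext]; exact hf.add hg
    · rw [hext, iterPartial_add isOpen_interior hf hg w.1 w.2 x hx, ← hf' w x hx, ← hg' w x hx]
      rfl
  zero_mem' := by
    have hext : extendZero K ((0 : {w : List ι // (w.length : ℕ∞) ≤ m} → C(K, ℝ)) ⟨[], by simp⟩)
        = 0 := extendZero_zero K
    refine ⟨?_, fun w x hx => ?_⟩
    · rw [hext]; exact contDiffOn_const
    · rw [hext, iterPartial_zero]; rfl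
  smul_mem' := by
    rintro c f ⟨hf, hf'⟩
    have hext : extendZero K ((c • f) ⟨[], by simp⟩) = c • extendZero K (f ⟨[], by simp⟩) :=
      extendZero_smul K c _
    refine ⟨?_, fun w x hx => ?_⟩
    · rw [hext]; exact hf.const_smul c
    · rw [hext, iterPartial_smul isOpen_interior c hf w.1 w.2 x hx, ← hf' w x hx]
      rfl

/-- The function on `K` underlying an element of `C^m(K)`. -/
def toFn {m : ℕ∞} {K : Compacts (ι → ℝ)} (f : CSpace m K) : C(K, ℝ) :=
  f.1 ⟨[], by simp⟩

/-- The Fréchet space `C^∞(K)`. -/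
abbrev CInfty (K : Compacts (ι → ℝ)) := CSpace (⊤ : ℕ∞) K

/-- The restriction to `K` of a polynomial function. Its norm is the sup norm on `K`. -/
def polyOn (K : Compacts (ι → ℝ)) (p : MvPolynomial ι ℝ) : C(K, ℝ) where
  toFun x := MvPolynomial.eval (x : ι → ℝ) p
  continuous_toFun := (MvPolynomial.continuous_eval p).comp continuous_subtype_val

/-- `K` is fat: it is the closure of its interior. -/
def IsFat (K : Compacts (ι → ℝ)) : Prop :=
  closure (interior (K : Set (ι → ℝ))) = K

/-- `K` is a `θ`-SBM compact set: there is a `θ`-strong Bernstein-Markov probability measure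
on `K`. Constant polynomials are left out since `(deg p)^θ = 0` for them; for constants
`‖p‖_K = ‖p‖₂` anyway. -/
def IsSBM (K : Compacts (ι → ℝ)) (θ : ℝ) : Prop :=
  0 < θ ∧ ∃ μ : Measure (ι → ℝ), IsProbabilityMeasure μ ∧ μ (K : Set (ι → ℝ))ᶜ = 0 ∧
    ∃ C : ℝ, 0 < C ∧ ∀ p : MvPolynomial ι ℝ, 0 < p.totalDegree →
      ‖polyOn K p‖ ≤ C * (p.totalDegree : ℝ) ^ θ *
        Real.sqrt (∫ x in (K : Set (ι → ℝ)), (MvPolynomial.eval x p) ^ 2 ∂μ)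

/-- The derivative of the polynomial `p` along the word `w`; the partial derivatives of
polynomials commute, so that these are the derivatives `D^α p` with `|α| = w.length`. -/
def polyDeriv (w : List ι) (p : MvPolynomial ι ℝ) : MvPolynomial ι ℝ :=
  w.foldr (fun i q => MvPolynomial.pderiv i q) p

/-- `K` satisfies a Markov inequality of exponent `r`. -/
def SatisfiesMarkov (K : Compacts (ι → ℝ)) (r : ℝ) : Prop :=
  ∃ M : ℝ, 0 < M ∧ ∀ (w : List ι) (p : MvPolynomial ι ℝ),
    ‖polyOn K (polyDeriv w p)‖ ≤ M * (p.totalDegree : ℝ) ^ (r * w.length) * ‖polyOn K p‖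

/-- `K` is a Jackson compact set: for every `m` and `f ∈ C^m(K)` there is a constant `M`
with `dist(f, Pol_d) ≤ M d^{-m}` for all `d ≥ 1`, the distance being that of the
sup norm on `K`. -/
def IsJackson (K : Compacts (ι → ℝ)) : Prop :=
  ∀ (m : ℕ) (f : CSpace (m : ℕ∞) K), ∃ M : ℝ, ∀ d : ℕ, 1 ≤ d →
    Metric.infDist (toFn f) (polyOn K '' {p | p.totalDegree ≤ d}) ≤ M * ((d : ℝ) ^ m)⁻¹

/-- The function `f ∈ C^∞(K)` is (the restriction of) a polynomial of total degree `≤ d`. -/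
def IsPolyOfDegreeLE {K : Compacts (ι → ℝ)} (d : ℕ) (f : CInfty K) : Prop :=
  ∃ p : MvPolynomial ι ℝ, p.totalDegree ≤ d ∧ toFn f = polyOn K p

/-- A polynomial projector of degree `d` on `C^∞(K)`: a continuous linear map with values in
the polynomials of degree `≤ d` that is the identity on these polynomials. -/
def IsPolynomialProjector {K : Compacts (ι → ℝ)} (d : ℕ) (P : CInfty K →L[ℝ] CInfty K) : Prop :=
  (∀ f, IsPolyOfDegreeLE d (P f)) ∧ ∀ f, IsPolyOfDegreeLE d f → P f = f

/-- The space of interpolation conditions of `P`: the continuous linear forms `ν` on `C^∞(K)`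
such that `ν(f) = ν(P f)` for all `f`. -/
def interpConditions {K : Compacts (ι → ℝ)} (P : CInfty K →L[ℝ] CInfty K) :
    Submodule ℝ (CInfty K →L[ℝ] ℝ) where
  carrier := {ν | ∀ f, ν f = ν (P f)}
  add_mem' := by
    intro a b ha hb f
    simp only [add_apply]
    rw [ha f, hb f]
  zero_mem' := fun _ => rfl
  smul_mem' := by
    intro c a ha f
    simp only [smul_apply]
    rw [ha f]

/-- A Newton sequence on `C^∞(K)`: polynomial projectors `Π_d` of degree `d`, `d ∈ ℕ`, whose
spaces of interpolation conditions increase with `d`. -/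
structure NewtonSequence (K : Compacts (ι → ℝ)) where
  /-- The projector of degree `d`. -/
  proj : ℕ → CInfty K →L[ℝ] CInfty K
  isProjector : ∀ d, IsPolynomialProjector d (proj d)
  nested : ∀ d, interpConditions (proj d) ≤ interpConditions (proj (d + 1))

/-- The Newton sequence converges on `C^∞(K)`: `Π_d f → f` in `C^∞(K)` for all `f ∈ C^∞(K)`. -/
def NewtonSequence.Converging {K : Compacts (ι → ℝ)} (N : NewtonSequence K) : Prop :=
  ∀ f : CInfty K, Tendsto (fun d => N.proj d f) atTop (𝓝 f)

section Product

variable {ι₁ ι₂ : Type*} [Fintype ι₁] [DecidableEq ι₁] [Fintype ι₂] [DecidableEq ι₂]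

/-- The Cartesian product `K₁ × K₂`, the product of `ℝ^{ι₁}` and `ℝ^{ι₂}` being identified
with `ℝ^{ι₁ ⊕ ι₂}`. -/
def prodCompacts (K₁ : Compacts (ι₁ → ℝ)) (K₂ : Compacts (ι₂ → ℝ)) :
    Compacts (ι₁ ⊕ ι₂ → ℝ) where
  carrier := {z | z ∘ Sum.inl ∈ K₁ ∧ z ∘ Sum.inr ∈ K₂}
  isCompact' := by
    have h := (Homeomorph.sumArrowHomeomorphProdArrow (ι := ι₁) (ι' := ι₂)
      (X := ℝ)).isCompact_preimage.2 (K₁.isCompact.prod K₂.isCompact)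
    exact h

/-- `h(x, y) = f₁(x) f₂(y)` for all `(x, y) ∈ K₁ × K₂`. -/
def IsProductFunction {K₁ : Compacts (ι₁ → ℝ)} {K₂ : Compacts (ι₂ → ℝ)}
    (f₁ : CInfty K₁) (f₂ : CInfty K₂) (h : CInfty (prodCompacts K₁ K₂)) : Prop :=
  ∀ z : prodCompacts K₁ K₂,
    toFn h z = toFn f₁ ⟨(z : ι₁ ⊕ ι₂ → ℝ) ∘ Sum.inl, z.2.1⟩ *
      toFn f₂ ⟨(z : ι₁ ⊕ ι₂ → ℝ) ∘ Sum.inr, z.2.2⟩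

/-- The continuous linear form `l` on `C^∞(K₁ × K₂)` is the tensor product `μ ⊗ ν`:
`l(f₁ f₂) = μ(f₁) ν(f₂)` for all product functions `f₁ f₂`. -/
def IsTensor {K₁ : Compacts (ι₁ → ℝ)} {K₂ : Compacts (ι₂ → ℝ)}
    (μ : CInfty K₁ →L[ℝ] ℝ) (ν : CInfty K₂ →L[ℝ] ℝ)
    (l : CInfty (prodCompacts K₁ K₂) →L[ℝ] ℝ) : Prop :=
  ∀ f₁ f₂ h, IsProductFunction f₁ f₂ h → l h = μ f₁ * ν f₂

/-- `N` is the Newton product of `N₁` and `N₂`: the interpolation conditions of the projector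
of degree `d` are spanned by the tensor products `μ ⊗ ν`, where `μ` is an interpolation condition
of the projector of degree `i` of `N₁`, `ν` one of the projector of degree `j` of `N₂`, and
`i + j ≤ d`. (Given bases `μ_α`, `ν_β` such that the `μ_α`, `|α| ≤ k`, and the `ν_β`, `|β| ≤ k`,
span the conditions of the projectors of degree `k` of `N₁` and of `N₂`, this is the span of
the `μ_α ⊗ ν_β` with `|α| + |β| ≤ d`.) -/
def IsNewtonProduct {K₁ : Compacts (ι₁ → ℝ)} {K₂ : Compacts (ι₂ → ℝ)}
    (N₁ : NewtonSequence K₁) (N₂ : NewtonSequence K₂)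
    (N : NewtonSequence (prodCompacts K₁ K₂)) : Prop :=
  ∀ d : ℕ, interpConditions (N.proj d) =
    Submodule.span ℝ {l | ∃ i j : ℕ, i + j ≤ d ∧
      ∃ μ ∈ interpConditions (N₁.proj i), ∃ ν ∈ interpConditions (N₂.proj j), IsTensor μ ν l}

end Product

end NewtonProduct

end

/-! The product projectors have an explicit form: `P_d = ∑_{k ≤ d} (Π¹_k - Π¹_{k-1}) ⊗ Π²_{d-k}`,
with `Π¹_{-1} = 0`. If `f` and `g` are polynomials of degrees at most `a` and `b`, `a + b ≤ d`, the
increments with `k > a` kill `f`, and for `k ≤ a` the projector of degree `d - k ≥ b` fixes `g`; the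
sum telescopes to `fg`. The same summation, applied to conditions `μ` and `ν` instead of
polynomials, shows that `μ ⊗ ν` is a condition of `P_d` (`sum_bilin_eq`,
`exists_product_projector`). Conversely the increments and projectors have finite rank with
coordinates that are themselves conditions, so every condition of `P_d` is a combination of such
tensor products. Uniqueness holds because a projector of given degree is determined by its
conditions (`IsPolynomialProjector.eq_of_interpConditions`).

Tensor products of forms are built on polynomials by contracting one group of variables at a time,
then extended by Hahn-Banach (`exists_extension_of_bound`, `exists_tensor`). They are characterized
by their values on products because polynomials are dense: on the factors by convergence of the
given Newton sequences, on the product by the Jackson property together with Markov's inequality,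
which passes to products.

Convergence is a trade of polynomial growth against rapid approximation. Each `C^∞(K)` is barrelled,
so the pointwise convergent projectors are equicontinuous, and Markov's inequality turns this into
`‖Π_n p‖ ≤ C e^A ‖p‖` for `deg p ≤ e`, uniformly in `n` (`MarkovBound.exists_uniform_bound`). Such
bounds multiply under tensor products, and `P_d` has only `d + 1` summands (`exists_product_bound`).
A smooth `f` on a Jackson set has approximants `Q_n` of degree at most `n` converging faster than
any power of `n`; as `P_d` fixes `Q_d`, the error `P_d f - f` is the sum over `n ≥ d` of the errors
of `Q_{n+1} - Q_n`, and each derivative of this sum is `O(1/d)` (`tendsto_projectors`). -/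

noncomputable section

namespace NewtonProduct

set_option linter.unusedSectionVars false

/-! ### The Fréchet space of smooth functions and its polynomials. -/

section Space

variable {ι : Type*} [Fintype ι] [DecidableEq ι] {K : Compacts (ι → ℝ)}

/-- Words of arbitrary length, as indices of the derivatives of smooth functions. -/
abbrev Word (ι : Type*) := {w : List ι // (w.length : ℕ∞) ≤ (⊤ : ℕ∞)}

/-- A word, regarded as an index of a derivative. -/
def word (w : List ι) : Word ι := ⟨w, le_top⟩

/-- The linear form on `ℝ^ι` with the given coefficients. -/
def formOf (c : ι → ℝ) : (ι → ℝ) →L[ℝ] ℝ :=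
  ∑ i, c i • (ContinuousLinearMap.proj i : (ι → ℝ) →L[ℝ] ℝ)

lemma formOf_apply (c v : ι → ℝ) : formOf c v = ∑ i, c i * v i := by
  simp [formOf]

lemma formOf_single (c : ι → ℝ) (i : ι) : formOf c (Pi.single i 1) = c i := by
  simp [formOf_apply, Pi.single_apply]

lemma eq_formOf (L : (ι → ℝ) →L[ℝ] ℝ) : L = formOf fun i => L (Pi.single i 1) := by
  ext v
  have h := LinearMap.pi_apply_eq_sum_univ (L : (ι → ℝ) →ₗ[ℝ] ℝ) v
  rw [formOf_apply]
  calc L v = _ := h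
    _ = _ := by
      refine Finset.sum_congr rfl fun i _ => ?_
      have : (fun j => if i = j then (1 : ℝ) else 0) = Pi.single i 1 := by
        funext j
        simp [Pi.single_apply, eq_comm]
      rw [smul_eq_mul, mul_comm, this]
      rfl

lemma norm_formOf_le (c : ι → ℝ) : ‖formOf c‖ ≤ ∑ i, ‖c i‖ := by
  refine ContinuousLinearMap.opNorm_le_bound _ (by positivity) fun v => ?_
  rw [formOf_apply, Finset.sum_mul]
  refine (norm_sum_le _ _).trans (Finset.sum_le_sum fun i _ => ?_)
  rw [norm_mul]
  gcongr
  exact norm_le_pi_norm v i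

lemma formOf_sub (c d : ι → ℝ) : formOf c - formOf d = formOf fun i => c i - d i := by
  ext v
  simp [formOf_apply, sub_mul]

lemma extendZero_apply (f : C(K, ℝ)) (x : K) : extendZero K f x = f x :=
  Subtype.val_injective.extend_apply f 0 x

lemma extendZero_of_mem (f : C(K, ℝ)) {x : ι → ℝ} (hx : x ∈ K) :
    extendZero K f x = f ⟨x, hx⟩ := extendZero_apply f ⟨x, hx⟩

lemma interior_mem {x : ι → ℝ} (hx : x ∈ interior (K : Set (ι → ℝ))) : x ∈ K :=
  interior_subset hx

/-- The differential relations between the members of the family of derivatives. -/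
lemma hasFDerivAt_of_mem (f : CInfty K) (w : List ι) {x : ι → ℝ}
    (hx : x ∈ interior (K : Set (ι → ℝ))) :
    HasFDerivAt (extendZero K (f.1 (word w)))
      (formOf fun i => f.1 (word (i :: w)) ⟨x, interior_mem hx⟩) x := by
  obtain ⟨g, hg, hg'⟩ := f
  have heq : extendZero K (g (word w)) =ᶠ[𝓝 x] iterPartial w (extendZero K (g (word []))) := by
    filter_upwards [isOpen_interior.mem_nhds hx] with y hy
    rw [extendZero_of_mem _ (interior_mem hy)]
    exact hg' (word w) ⟨y, interior_mem hy⟩ hy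
  have hd := differentiableAt_iterPartial isOpen_interior hg w le_top hx
  have h := hd.hasFDerivAt.congr_of_eventuallyEq heq
  rw [eq_formOf (fderiv ℝ _ x)] at h
  convert! h using 2
  funext i
  exact hg' (word (i :: w)) ⟨x, interior_mem hx⟩ hx

/-- The induction on `n` runs over all words at once: the coefficients of the derivative of one
member are again members of the family. -/
lemma contDiffOn_extendZero {g : Word ι → C(K, ℝ)}
    (h : ∀ (w : List ι) (x : ι → ℝ) (hx : x ∈ interior (K : Set (ι → ℝ))),
      HasFDerivAt (extendZero K (g (word w)))
        (formOf fun i => g (word (i :: w)) ⟨x, interior_mem hx⟩) x) (n : ℕ) :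
    ∀ w : List ι, ContDiffOn ℝ n (extendZero K (g (word w))) (interior (K : Set (ι → ℝ))) := by
  induction n with
  | zero =>
    intro w
    rw [Nat.cast_zero, contDiffOn_zero]
    exact fun x hx => (h w x hx).continuousAt.continuousWithinAt
  | succ n ih =>
    intro w
    rw [Nat.cast_succ, contDiffOn_succ_iff_fderiv_of_isOpen isOpen_interior]
    refine ⟨fun x hx => (h w x hx).differentiableAt.differentiableWithinAt, by simp, ?_⟩
    have h1 : ContDiffOn ℝ n (fun x => ∑ i, extendZero K (g (word (i :: w))) x •
        (ContinuousLinearMap.proj i : (ι → ℝ) →L[ℝ] ℝ)) (interior (K : Set (ι → ℝ))) :=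
      ContDiffOn.sum fun i _ => (ih (i :: w)).smul contDiffOn_const
    refine h1.congr fun x hx => ?_
    rw [(h w x hx).fderiv, formOf]
    simp only [extendZero_of_mem _ (interior_mem hx)]

/-- Smooth functions are the families that satisfy the differential relations. -/
lemma mem_cInfty_of_hasFDerivAt {g : Word ι → C(K, ℝ)}
    (h : ∀ (w : List ι) (x : ι → ℝ) (hx : x ∈ interior (K : Set (ι → ℝ))),
      HasFDerivAt (extendZero K (g (word w)))
        (formOf fun i => g (word (i :: w)) ⟨x, interior_mem hx⟩) x) :
    g ∈ CSpace (⊤ : ℕ∞) K := by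
  have key : ∀ (w : List ι), ∀ x ∈ interior (K : Set (ι → ℝ)),
      iterPartial w (extendZero K (g (word []))) x = extendZero K (g (word w)) x := by
    intro w
    induction w with
    | nil => exact fun x _ => rfl
    | cons i w ih =>
      intro x hx
      have heq : iterPartial w (extendZero K (g (word []))) =ᶠ[𝓝 x] extendZero K (g (word w)) := by
        filter_upwards [isOpen_interior.mem_nhds hx] with y hy using ih y hy
      simp only [iterPartial]
      rw [heq.fderiv_eq, (h w x hx).fderiv, formOf_single, extendZero_of_mem _ (interior_mem hx)]
  refine ⟨?_, fun w x hx => ?_⟩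
  · exact contDiffOn_infty.2 fun n => contDiffOn_extendZero h n []
  · exact ((key w.1 x hx).trans (extendZero_apply _ x)).symm

/-- The differential relations survive limits, because all members of the family converge uniformly
on the interior. There are countably many words, so sequences suffice. -/
lemma isClosed_cInfty :
    IsClosed ((CSpace (⊤ : ℕ∞) K : Submodule ℝ (Word ι → C(K, ℝ))) : Set (Word ι → C(K, ℝ))) := by
  refine IsSeqClosed.isClosed fun u g hu hg => mem_cInfty_of_hasFDerivAt fun w x hx => ?_
  have hlim : ∀ v : List ι, Tendsto (fun n => u n (word v)) atTop (𝓝 (g (word v))) :=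
    fun v => tendsto_pi_nhds.1 hg (word v)
  set U := interior (K : Set (ι → ℝ))
  -- The derivative, made total by extension by zero, so that uniform convergence can be stated
  -- without membership proofs.
  let D : (Word ι → C(K, ℝ)) → (ι → ℝ) → (ι → ℝ) →L[ℝ] ℝ :=
    fun q y => formOf fun i => extendZero K (q (word (i :: w))) y
  have hD : ∀ (q : Word ι → C(K, ℝ)) y (hy : y ∈ U),
      D q y = formOf fun i => q (word (i :: w)) ⟨y, interior_mem hy⟩ := by
    intro q y hy
    simp only [D, extendZero_of_mem _ (interior_mem hy)]
  rw [← hD g x hx]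
  refine hasFDerivAt_of_tendstoUniformlyOn (f := fun n => extendZero K (u n (word w)))
    (f' := fun n => D (u n)) (l := atTop) isOpen_interior ?_ ?_ ?_ hx
  · rw [Metric.tendstoUniformlyOn_iff]
    intro ε hε
    have hs : Tendsto (fun n => ∑ i, ‖g (word (i :: w)) - u n (word (i :: w))‖) atTop (𝓝 0) := by
      rw [← Finset.sum_const_zero (s := (Finset.univ : Finset ι))]
      refine tendsto_finsetSum _ fun i _ => ?_
      have := (tendsto_const_nhds (x := g (word (i :: w)))).sub (hlim (i :: w))
      simpa using this.norm
    filter_upwards [hs.eventually (gt_mem_nhds hε)] with n hn y hy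
    rw [dist_eq_norm, hD _ _ hy, hD _ _ hy, formOf_sub]
    refine ((norm_formOf_le _).trans (Finset.sum_le_sum fun i _ => ?_)).trans_lt hn
    exact (g (word (i :: w)) - u n (word (i :: w))).norm_coe_le_norm ⟨y, interior_mem hy⟩
  · intro n y hy
    rw [hD _ _ hy]
    exact hasFDerivAt_of_mem ⟨u n, hu n⟩ w hy
  · intro y hy
    simp only [extendZero_of_mem _ (interior_mem hy)]
    exact ((continuous_eval_const _).tendsto _).comp (hlim w)

/-- A closed subspace of a countable product of Banach spaces is completely metrizable, hence Baire.
This is what makes the uniform boundedness principle available. -/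
instance barrelledSpace_cInfty : BarrelledSpace ℝ (CInfty K) := by
  have : IsCompletelyPseudoMetrizableSpace (CInfty K) :=
    isClosed_cInfty.isCompletelyPseudoMetrizableSpace
  infer_instance

/-- A continuous seminorm is bounded by the sup norms of finitely many derivatives. -/
lemma exists_bound_of_continuous_seminorm (q : Seminorm ℝ (CInfty K)) (hq : Continuous q) :
    ∃ (S : Finset (List ι)) (C : ℝ), 0 ≤ C ∧
      ∀ f : CInfty K, q f ≤ C * ∑ w ∈ S, ‖f.1 (word w)‖ := by
  classical
  have hw : WithSeminorms (SeminormFamily.sigma (fun w : Word ι =>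
      (SeminormFamily.comp (fun _ : Fin 1 => normSeminorm ℝ C(K, ℝ))
        (LinearMap.proj w : (Word ι → C(K, ℝ)) →ₗ[ℝ] C(K, ℝ))))) :=
    withSeminorms_pi fun _ => norm_withSeminorms ℝ _
  have hi : IsInducing (CSpace (⊤ : ℕ∞) K).subtype := IsInducing.subtypeVal
  obtain ⟨s, C, -, h⟩ := Seminorm.bound_of_continuous (hi.withSeminorms hw) q hq
  refine ⟨s.image fun a => a.1.1, C, C.2, fun f => ?_⟩
  refine (h f).trans ?_
  change (C : ℝ) * _ ≤ _
  gcongr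
  refine Seminorm.finset_sup_apply_le (by positivity) fun a ha => ?_
  exact Finset.single_le_sum (f := fun w => ‖f.1 (word w)‖) (fun _ _ => norm_nonneg _)
    (Finset.mem_image_of_mem (fun a => a.1.1) ha)

lemma exists_bound (μ : CInfty K →L[ℝ] ℝ) :
    ∃ (S : Finset (List ι)) (C : ℝ), 0 ≤ C ∧
      ∀ f : CInfty K, |μ f| ≤ C * ∑ w ∈ S, ‖f.1 (word w)‖ :=
  exists_bound_of_continuous_seminorm ((normSeminorm ℝ ℝ).comp (μ : CInfty K →ₗ[ℝ] ℝ))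
    (continuous_norm.comp μ.continuous)

/-- On a fat compact set a smooth function determines its derivatives. -/
lemma toFn_injective (hK : IsFat K) : Function.Injective (toFn : CInfty K → C(K, ℝ)) := by
  intro f g hfg
  have hd : Dense {x : K | (x : ι → ℝ) ∈ interior (K : Set (ι → ℝ))} := by
    intro x
    rw [closure_subtype]
    have himg : Subtype.val '' {x : K | (x : ι → ℝ) ∈ interior (K : Set (ι → ℝ))} =
        interior (K : Set (ι → ℝ)) := by
      ext y
      exact ⟨by rintro ⟨z, hz, rfl⟩; exact hz, fun hy => ⟨⟨y, interior_mem hy⟩, hy, rfl⟩⟩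
    rw [himg, hK]
    exact x.2
  ext w : 2
  refine ContinuousMap.coe_injective (Continuous.ext_on hd (f.1 w).continuous (g.1 w).continuous ?_)
  intro x hx
  rw [f.2.2 w x hx, g.2.2 w x hx]
  simp only [toFn] at hfg
  rw [hfg]

lemma tendsto_cInfty_iff {α : Type*} {l : Filter α} {u : α → CInfty K} {f : CInfty K} :
    Tendsto u l (𝓝 f) ↔ ∀ w, Tendsto (fun a => (u a).1 (word w)) l (𝓝 (f.1 (word w))) := by
  rw [tendsto_subtype_rng, tendsto_pi_nhds]
  exact ⟨fun h w => h (word w), fun h w => h w.1⟩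

lemma mem_of_tendsto_family {u : ℕ → CInfty K} {g : Word ι → C(K, ℝ)}
    (h : ∀ w, Tendsto (fun n => (u n).1 (word w)) atTop (𝓝 (g (word w)))) :
    g ∈ CSpace (⊤ : ℕ∞) K :=
  isClosed_cInfty.mem_of_tendsto (tendsto_pi_nhds.2 fun w => h w.1)
    (Eventually.of_forall fun n => (u n).2)

/-- Only the limit of the functions themselves has to be identified: by closedness the limits of the
derivatives form a smooth function, and fatness leaves no choice for it. -/
lemma tendsto_of_family (hK : IsFat K) {u : ℕ → CInfty K} {f : CInfty K} {g : Word ι → C(K, ℝ)}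
    (h : ∀ w, Tendsto (fun n => (u n).1 (word w)) atTop (𝓝 (g (word w))))
    (hf : toFn f = g (word [])) : Tendsto u atTop (𝓝 f) := by
  have : f = ⟨g, mem_of_tendsto_family h⟩ := toFn_injective hK hf
  rw [this, tendsto_cInfty_iff]
  exact h

lemma eval_hasFDerivAt (p : MvPolynomial ι ℝ) (x : ι → ℝ) :
    HasFDerivAt (fun y => MvPolynomial.eval y p)
      (formOf fun i => MvPolynomial.eval x (MvPolynomial.pderiv i p)) x := by
  induction p using MvPolynomial.induction_on with
  | C a =>
    have : formOf (fun i : ι => MvPolynomial.eval x (MvPolynomial.pderiv i (MvPolynomial.C a)))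
        = 0 := by ext; simp [formOf_apply]
    rw [this]
    simpa using hasFDerivAt_const a x
  | add p q hp hq =>
    have := hp.add hq
    convert! this using 1
    · ext; simp
    · ext; simp [formOf_apply, add_mul, Finset.sum_add_distrib]
  | mul_X p j hp =>
    have := hp.mul (hasFDerivAt_apply (𝕜 := ℝ) j x)
    convert! this using 1
    · ext; simp
    · ext v
      simp only [MvPolynomial.pderiv_mul, MvPolynomial.pderiv_X, map_add, map_mul,
        MvPolynomial.eval_X, formOf_apply, add_apply, smul_apply, smul_eq_mul, add_mul,
        Finset.sum_add_distrib, ContinuousLinearMap.proj_apply]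
      rw [add_comm]
      congr 1
      · rw [Finset.sum_eq_single j]
        · simp
        · intro i _ hij
          simp [hij.symm]
        · simp
      · rw [Finset.mul_sum]
        exact Finset.sum_congr rfl fun i _ => by ring

@[simp] lemma polyOn_apply (p : MvPolynomial ι ℝ) (x : K) :
    polyOn K p x = MvPolynomial.eval (x : ι → ℝ) p := rfl

lemma polyDeriv_cons (i : ι) (w : List ι) (p : MvPolynomial ι ℝ) :
    polyDeriv (i :: w) p = MvPolynomial.pderiv i (polyDeriv w p) := rfl

/-- Differentiation of polynomials along a word as a linear map. -/
def polyDerivₗ (w : List ι) : MvPolynomial ι ℝ →ₗ[ℝ] MvPolynomial ι ℝ where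
  toFun := polyDeriv w
  map_add' p q := by
    induction w with
    | nil => rfl
    | cons i w ih => simp only [polyDeriv_cons, ih, map_add]
  map_smul' c p := by
    induction w with
    | nil => rfl
    | cons i w ih => simp only [polyDeriv_cons, ih, Derivation.map_smul, RingHom.id_apply]

@[simp] lemma polyDerivₗ_apply (w : List ι) (p : MvPolynomial ι ℝ) :
    polyDerivₗ w p = polyDeriv w p := rfl

/-- Restriction of polynomials to `K` as a linear map. -/
def polyOnₗ (K : Compacts (ι → ℝ)) : MvPolynomial ι ℝ →ₗ[ℝ] C(K, ℝ) where
  toFun := polyOn K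
  map_add' p q := by ext; simp
  map_smul' c p := by ext; simp

@[simp] lemma polyOnₗ_apply (p : MvPolynomial ι ℝ) : polyOnₗ K p = polyOn K p := rfl

/-- Polynomials as elements of `C^∞(K)`. -/
def polyC (K : Compacts (ι → ℝ)) : MvPolynomial ι ℝ →ₗ[ℝ] CInfty K :=
  LinearMap.codRestrict (CSpace (⊤ : ℕ∞) K)
    (LinearMap.pi fun w : Word ι => polyOnₗ K ∘ₗ polyDerivₗ w.1) fun p => by
      refine mem_cInfty_of_hasFDerivAt fun w x hx => ?_
      refine (eval_hasFDerivAt (polyDeriv w p) x).congr_of_eventuallyEq ?_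
      filter_upwards [isOpen_interior.mem_nhds hx] with y hy
      rw [extendZero_of_mem _ (interior_mem hy)]
      rfl

lemma polyC_val (p : MvPolynomial ι ℝ) (w : List ι) :
    (polyC K p).1 (word w) = polyOn K (polyDeriv w p) := rfl

lemma toFn_polyC (p : MvPolynomial ι ℝ) : toFn (polyC K p) = polyOn K p := rfl

lemma isPolyOfDegreeLE_iff (hK : IsFat K) {d : ℕ} {f : CInfty K} :
    IsPolyOfDegreeLE d f ↔ ∃ p : MvPolynomial ι ℝ, p.totalDegree ≤ d ∧ f = polyC K p :=
  ⟨fun ⟨p, hp, h⟩ => ⟨p, hp, toFn_injective hK h⟩, fun ⟨p, hp, h⟩ => ⟨p, hp, by rw [h]; rfl⟩⟩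

end Space

/-! ### Polynomials in two groups of variables and partial contractions. -/

section Algebra

open MvPolynomial

variable {ι₁ ι₂ : Type*} [Fintype ι₁] [DecidableEq ι₁] [Fintype ι₂] [DecidableEq ι₂]

/-- The polynomial `p(x) q(y)`. -/
def polyMul (p : MvPolynomial ι₁ ℝ) (q : MvPolynomial ι₂ ℝ) : MvPolynomial (ι₁ ⊕ ι₂) ℝ :=
  rename Sum.inl p * rename Sum.inr q

lemma polyMul_add_left (p p' : MvPolynomial ι₁ ℝ) (q : MvPolynomial ι₂ ℝ) :
    polyMul (p + p') q = polyMul p q + polyMul p' q := by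
  simp [polyMul, add_mul]

lemma polyMul_add_right (p : MvPolynomial ι₁ ℝ) (q q' : MvPolynomial ι₂ ℝ) :
    polyMul p (q + q') = polyMul p q + polyMul p q' := by
  simp [polyMul, mul_add]

lemma polyMul_monomial (s : ι₁ →₀ ℕ) (t : ι₂ →₀ ℕ) (a b : ℝ) :
    polyMul (monomial s a) (monomial t b) = monomial (s.sumElim t) (a * b) := by
  rw [polyMul, rename_monomial, rename_monomial, monomial_mul]
  congr 2
  ext z
  rcases z with i | j
  · simp [Finsupp.mapDomain_apply Sum.inl_injective, Finsupp.mapDomain_of_notMem_range]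
  · simp [Finsupp.mapDomain_apply Sum.inr_injective, Finsupp.mapDomain_of_notMem_range]

lemma monomial_eq_polyMul (m : ι₁ ⊕ ι₂ →₀ ℕ) (c : ℝ) :
    monomial m c = polyMul
      (monomial (m.comapDomain Sum.inl Sum.inl_injective.injOn) c)
      (monomial (m.comapDomain Sum.inr Sum.inr_injective.injOn) 1) := by
  rw [polyMul_monomial, mul_one, Finsupp.comapDomain_sumElim_comapDomain]

lemma totalDegree_polyMul_le (p : MvPolynomial ι₁ ℝ) (q : MvPolynomial ι₂ ℝ) :
    (polyMul p q).totalDegree ≤ p.totalDegree + q.totalDegree :=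
  (totalDegree_mul _ _).trans
    (add_le_add (totalDegree_rename_le _ _) (totalDegree_rename_le _ _))

lemma eval_polyMul (p : MvPolynomial ι₁ ℝ) (q : MvPolynomial ι₂ ℝ) (z : ι₁ ⊕ ι₂ → ℝ) :
    eval z (polyMul p q) = eval (z ∘ Sum.inl) p * eval (z ∘ Sum.inr) q := by
  simp [polyMul, eval_rename]

/-- Linear maps on polynomials in two groups of variables are determined by the products. -/
lemma polyMul_ext {M : Type*} [AddCommGroup M] [Module ℝ M]
    {f g : MvPolynomial (ι₁ ⊕ ι₂) ℝ →ₗ[ℝ] M}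
    (h : ∀ p q, f (polyMul p q) = g (polyMul p q)) (r : MvPolynomial (ι₁ ⊕ ι₂) ℝ) :
    f r = g r := by
  induction r using MvPolynomial.induction_on' with
  | monomial m c => rw [monomial_eq_polyMul, h]
  | add p q hp hq => rw [map_add, map_add, hp, hq]

/-- Application of a linear form to a polynomial with respect to the first group of variables. -/
def contractLeft (l : MvPolynomial ι₁ ℝ →ₗ[ℝ] ℝ) :
    MvPolynomial (ι₁ ⊕ ι₂) ℝ →ₗ[ℝ] MvPolynomial ι₂ ℝ :=
  (basisMonomials (ι₁ ⊕ ι₂) ℝ).constr ℝ fun m =>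
    monomial (m.comapDomain Sum.inr Sum.inr_injective.injOn)
      (l (monomial (m.comapDomain Sum.inl Sum.inl_injective.injOn) 1))

lemma contractLeft_monomial (l : MvPolynomial ι₁ ℝ →ₗ[ℝ] ℝ) (m : ι₁ ⊕ ι₂ →₀ ℕ) (c : ℝ) :
    contractLeft l (monomial m c) = monomial (m.comapDomain Sum.inr Sum.inr_injective.injOn)
      (c * l (monomial (m.comapDomain Sum.inl Sum.inl_injective.injOn) 1)) := by
  have h : monomial m c = c • basisMonomials (ι₁ ⊕ ι₂) ℝ m := by
    rw [coe_basisMonomials, smul_monomial, smul_eq_mul, mul_one]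
  rw [h, map_smul, contractLeft, Module.Basis.constr_basis, smul_monomial, smul_eq_mul]

lemma contractLeft_polyMul (l : MvPolynomial ι₁ ℝ →ₗ[ℝ] ℝ) (p : MvPolynomial ι₁ ℝ)
    (q : MvPolynomial ι₂ ℝ) : contractLeft l (polyMul p q) = l p • q := by
  induction p using MvPolynomial.induction_on' with
  | monomial s a =>
    induction q using MvPolynomial.induction_on' with
    | monomial t b =>
      have h : l (monomial s a) = a * l (monomial s 1) := by
        rw [← smul_eq_mul, ← map_smul, smul_monomial, smul_eq_mul, mul_one]
      rw [polyMul_monomial, contractLeft_monomial, smul_monomial, h,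
        Finsupp.comapDomain_inl_sumElim, Finsupp.comapDomain_inr_sumElim, smul_eq_mul]
      congr 1
      ring
    | add p q hp hq => rw [polyMul_add_right, map_add, hp, hq, smul_add]
  | add p q hp hq => rw [polyMul_add_left, map_add, hp, hq, map_add, add_smul]

lemma totalDegree_contractLeft_le (l : MvPolynomial ι₁ ℝ →ₗ[ℝ] ℝ)
    (r : MvPolynomial (ι₁ ⊕ ι₂) ℝ) : (contractLeft l r).totalDegree ≤ r.totalDegree := by
  conv_lhs => rw [r.as_sum, map_sum]
  refine (totalDegree_finsetSum _ _).trans (Finset.sup_le fun m hm => ?_)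
  rw [contractLeft_monomial]
  refine (totalDegree_monomial_le _ _).trans (le_trans ?_ (le_totalDegree hm))
  rw [Finsupp.sum_fintype _ _ (by simp), Finsupp.sum_fintype _ _ (by simp), Fintype.sum_sum_type]
  exact Nat.le_add_left _ _

/-- Application of a linear form to a polynomial with respect to the second group of
variables. -/
def contractRight (l : MvPolynomial ι₂ ℝ →ₗ[ℝ] ℝ) :
    MvPolynomial (ι₁ ⊕ ι₂) ℝ →ₗ[ℝ] MvPolynomial ι₁ ℝ :=
  contractLeft l ∘ₗ (rename Sum.swap).toLinearMap

lemma contractRight_polyMul (l : MvPolynomial ι₂ ℝ →ₗ[ℝ] ℝ) (p : MvPolynomial ι₁ ℝ)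
    (q : MvPolynomial ι₂ ℝ) : contractRight l (polyMul p q) = l q • p := by
  have h : rename Sum.swap (polyMul p q) = polyMul q p := by
    simp only [polyMul, map_mul, rename_rename]
    rw [mul_comm]
    rfl
  rw [contractRight, LinearMap.comp_apply, AlgHom.toLinearMap_apply, h, contractLeft_polyMul]

lemma totalDegree_contractRight_le (l : MvPolynomial ι₂ ℝ →ₗ[ℝ] ℝ)
    (r : MvPolynomial (ι₁ ⊕ ι₂) ℝ) : (contractRight l r).totalDegree ≤ r.totalDegree :=
  (totalDegree_contractLeft_le _ _).trans (totalDegree_rename_le _ _)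

/-- Evaluation of polynomials at a point as a linear form. -/
def evalₗ {ι : Type*} (x : ι → ℝ) : MvPolynomial ι ℝ →ₗ[ℝ] ℝ where
  toFun := eval x
  map_add' := map_add _
  map_smul' c p := by simp

@[simp] lemma evalₗ_apply {ι : Type*} (x : ι → ℝ) (p : MvPolynomial ι ℝ) :
    evalₗ x p = eval x p := rfl

/-- A Fubini identity: both sides are linear in `r` and agree on products. It reduces pointwise
bounds for a contraction to bounds for `l` on slices of `r`. -/
lemma eval_contractLeft (l : MvPolynomial ι₁ ℝ →ₗ[ℝ] ℝ) (r : MvPolynomial (ι₁ ⊕ ι₂) ℝ)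
    (y : ι₂ → ℝ) : eval y (contractLeft l r) = l (contractRight (evalₗ y) r) :=
  polyMul_ext (f := evalₗ y ∘ₗ contractLeft l) (g := l ∘ₗ contractRight (evalₗ y))
    (fun p q => by
      simp only [LinearMap.comp_apply, contractLeft_polyMul, contractRight_polyMul, map_smul,
        evalₗ_apply, smul_eq_mul, mul_comm]) r

lemma eval_contractRight_eval (r : MvPolynomial (ι₁ ⊕ ι₂) ℝ) (x : ι₁ → ℝ) (y : ι₂ → ℝ) :
    eval x (contractRight (evalₗ y) r) = eval (Sum.elim x y) r :=
  polyMul_ext (f := evalₗ x ∘ₗ contractRight (evalₗ y)) (g := evalₗ (Sum.elim x y))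
    (fun p q => by
      simp only [LinearMap.comp_apply, contractRight_polyMul, map_smul, eval_polyMul,
        evalₗ_apply, smul_eq_mul, mul_comm, Sum.elim_comp_inl, Sum.elim_comp_inr]) r

lemma eval_contractLeft_eval (r : MvPolynomial (ι₁ ⊕ ι₂) ℝ) (x : ι₁ → ℝ) (y : ι₂ → ℝ) :
    eval y (contractLeft (evalₗ x) r) = eval (Sum.elim x y) r := by
  rw [eval_contractLeft, evalₗ_apply, eval_contractRight_eval]

lemma pderiv_inl_polyMul (i : ι₁) (p : MvPolynomial ι₁ ℝ) (q : MvPolynomial ι₂ ℝ) :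
    pderiv (Sum.inl i) (polyMul p q) = polyMul (pderiv i p) q := by
  have h : pderiv (Sum.inl i) (rename Sum.inr q : MvPolynomial (ι₁ ⊕ ι₂) ℝ) = 0 := by
    refine pderiv_eq_zero_of_notMem_vars fun hi => ?_
    have := vars_rename _ _ hi
    simp at this
  rw [polyMul, pderiv_mul, h, mul_zero, add_zero, pderiv_rename Sum.inl_injective, polyMul]

lemma pderiv_inr_polyMul (j : ι₂) (p : MvPolynomial ι₁ ℝ) (q : MvPolynomial ι₂ ℝ) :
    pderiv (Sum.inr j) (polyMul p q) = polyMul p (pderiv j q) := by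
  have h : pderiv (Sum.inr j) (rename Sum.inl p : MvPolynomial (ι₁ ⊕ ι₂) ℝ) = 0 := by
    refine pderiv_eq_zero_of_notMem_vars fun hi => ?_
    have := vars_rename _ _ hi
    simp at this
  rw [polyMul, pderiv_mul, h, zero_mul, zero_add, pderiv_rename Sum.inr_injective, polyMul]

lemma pderiv_contractLeft (l : MvPolynomial ι₁ ℝ →ₗ[ℝ] ℝ) (j : ι₂)
    (r : MvPolynomial (ι₁ ⊕ ι₂) ℝ) :
    pderiv j (contractLeft l r) = contractLeft l (pderiv (Sum.inr j) r) :=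
  polyMul_ext (f := (pderiv j).toLinearMap ∘ₗ contractLeft l)
    (g := contractLeft l ∘ₗ (pderiv (Sum.inr j)).toLinearMap)
    (fun p q => by
      change pderiv j (contractLeft l (polyMul p q)) =
        contractLeft l (pderiv (Sum.inr j) (polyMul p q))
      simp only [contractLeft_polyMul, pderiv_inr_polyMul, Derivation.map_smul]) r

lemma pderiv_contractRight (l : MvPolynomial ι₂ ℝ →ₗ[ℝ] ℝ) (i : ι₁)
    (r : MvPolynomial (ι₁ ⊕ ι₂) ℝ) :
    pderiv i (contractRight l r) = contractRight l (pderiv (Sum.inl i) r) :=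
  polyMul_ext (f := (pderiv i).toLinearMap ∘ₗ contractRight l)
    (g := contractRight l ∘ₗ (pderiv (Sum.inl i)).toLinearMap)
    (fun p q => by
      change pderiv i (contractRight l (polyMul p q)) =
        contractRight l (pderiv (Sum.inl i) (polyMul p q))
      simp only [contractRight_polyMul, pderiv_inl_polyMul, Derivation.map_smul]) r

lemma polyDeriv_contractLeft (l : MvPolynomial ι₁ ℝ →ₗ[ℝ] ℝ) (w : List ι₂)
    (r : MvPolynomial (ι₁ ⊕ ι₂) ℝ) :
    polyDeriv w (contractLeft l r) = contractLeft l (polyDeriv (w.map Sum.inr) r) := by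
  induction w with
  | nil => rfl
  | cons i w ih => rw [polyDeriv_cons, ih, pderiv_contractLeft, List.map_cons, polyDeriv_cons]

lemma polyDeriv_contractRight (l : MvPolynomial ι₂ ℝ →ₗ[ℝ] ℝ) (w : List ι₁)
    (r : MvPolynomial (ι₁ ⊕ ι₂) ℝ) :
    polyDeriv w (contractRight l r) = contractRight l (polyDeriv (w.map Sum.inl) r) := by
  induction w with
  | nil => rfl
  | cons i w ih => rw [polyDeriv_cons, ih, pderiv_contractRight, List.map_cons, polyDeriv_cons]

lemma polyDeriv_append {ι : Type*} (v w : List ι) (p : MvPolynomial ι ℝ) :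
    polyDeriv (v ++ w) p = polyDeriv v (polyDeriv w p) := by
  simp [polyDeriv]

/-- The letters of a word that belong to the first group of variables. -/
def leftPart (w : List (ι₁ ⊕ ι₂)) : List ι₁ := w.filterMap Sum.getLeft?

/-- The letters of a word that belong to the second group of variables. -/
def rightPart (w : List (ι₁ ⊕ ι₂)) : List ι₂ := w.filterMap Sum.getRight?

lemma polyDeriv_polyMul (w : List (ι₁ ⊕ ι₂)) (p : MvPolynomial ι₁ ℝ) (q : MvPolynomial ι₂ ℝ) :
    polyDeriv w (polyMul p q) = polyMul (polyDeriv (leftPart w) p) (polyDeriv (rightPart w) q) := by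
  induction w with
  | nil => rfl
  | cons i w ih =>
    rw [polyDeriv_cons, ih]
    rcases i with i | j
    · exact pderiv_inl_polyMul i _ _
    · exact pderiv_inr_polyMul j _ _

lemma totalDegree_pderiv_le {ι : Type*} (i : ι) (p : MvPolynomial ι ℝ) :
    (pderiv i p).totalDegree ≤ p.totalDegree := by
  refine Finset.sup_le fun m hm => ?_
  rw [mem_support_iff, coeff_pderiv] at hm
  have h : m + Finsupp.single i 1 ∈ p.support := mem_support_iff.2 (left_ne_zero_of_mul hm)
  refine le_trans ?_ (le_totalDegree h)
  rw [Finsupp.sum_add_index' (by simp) (by simp)]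
  exact Nat.le_add_right _ _

end Algebra

/-! ### Products of smooth functions on the product set. -/

section ProductSpace

variable {ι₁ ι₂ : Type*} [Fintype ι₁] [DecidableEq ι₁] [Fintype ι₂] [DecidableEq ι₂]
  {K₁ : Compacts (ι₁ → ℝ)} {K₂ : Compacts (ι₂ → ℝ)}

lemma coe_prodCompacts (K₁ : Compacts (ι₁ → ℝ)) (K₂ : Compacts (ι₂ → ℝ)) :
    (prodCompacts K₁ K₂ : Set (ι₁ ⊕ ι₂ → ℝ)) =
      (Homeomorph.sumArrowHomeomorphProdArrow (ι := ι₁) (ι' := ι₂) (X := ℝ)) ⁻¹'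
        ((K₁ : Set (ι₁ → ℝ)) ×ˢ (K₂ : Set (ι₂ → ℝ))) := rfl

lemma interior_prodCompacts :
    interior (prodCompacts K₁ K₂ : Set (ι₁ ⊕ ι₂ → ℝ)) =
      (Homeomorph.sumArrowHomeomorphProdArrow (ι := ι₁) (ι' := ι₂) (X := ℝ)) ⁻¹'
        (interior (K₁ : Set (ι₁ → ℝ)) ×ˢ interior (K₂ : Set (ι₂ → ℝ))) := by
  rw [coe_prodCompacts, ← Homeomorph.preimage_interior, interior_prod_eq]

lemma IsFat.prodCompacts (h₁ : IsFat K₁) (h₂ : IsFat K₂) : IsFat (prodCompacts K₁ K₂) := by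
  rw [IsFat, interior_prodCompacts, ← Homeomorph.preimage_closure, closure_prod_eq, h₁, h₂,
    coe_prodCompacts]

/-- The first component of a point of `K₁ × K₂`. -/
def fstPt : C(prodCompacts K₁ K₂, K₁) where
  toFun z := ⟨(z : ι₁ ⊕ ι₂ → ℝ) ∘ Sum.inl, z.2.1⟩
  continuous_toFun := by
    refine Continuous.subtype_mk ?_ _
    exact continuous_pi fun i => (continuous_apply (Sum.inl i)).comp continuous_subtype_val

/-- The second component of a point of `K₁ × K₂`. -/
def sndPt : C(prodCompacts K₁ K₂, K₂) where
  toFun z := ⟨(z : ι₁ ⊕ ι₂ → ℝ) ∘ Sum.inr, z.2.2⟩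
  continuous_toFun := by
    refine Continuous.subtype_mk ?_ _
    exact continuous_pi fun i => (continuous_apply (Sum.inr i)).comp continuous_subtype_val

/-- The point of `K₁ × K₂` with the given components. -/
def pairPt (x : K₁) (y : K₂) : prodCompacts K₁ K₂ :=
  ⟨Sum.elim (x : ι₁ → ℝ) (y : ι₂ → ℝ), x.2, y.2⟩

lemma pairPt_fst_snd (z : prodCompacts K₁ K₂) : pairPt (fstPt z) (sndPt z) = z :=
  Subtype.ext (Sum.elim_comp_inl_inr _)

/-- The product `(x, y) ↦ f(x) g(y)`. -/
def funMul (f : C(K₁, ℝ)) (g : C(K₂, ℝ)) : C(prodCompacts K₁ K₂, ℝ) :=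
  f.comp fstPt * g.comp sndPt

@[simp] lemma funMul_apply (f : C(K₁, ℝ)) (g : C(K₂, ℝ)) (z : prodCompacts K₁ K₂) :
    funMul f g z = f (fstPt z) * g (sndPt z) := rfl

lemma polyOn_polyMul (p : MvPolynomial ι₁ ℝ) (q : MvPolynomial ι₂ ℝ) :
    polyOn (prodCompacts K₁ K₂) (polyMul p q) = funMul (polyOn K₁ p) (polyOn K₂ q) := by
  ext z
  exact eval_polyMul p q z

lemma tendsto_funMul {α : Type*} {l : Filter α} {u : α → C(K₁, ℝ)} {v : α → C(K₂, ℝ)}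
    {f : C(K₁, ℝ)} {g : C(K₂, ℝ)} (hu : Tendsto u l (𝓝 f)) (hv : Tendsto v l (𝓝 g)) :
    Tendsto (fun a => funMul (u a) (v a)) l (𝓝 (funMul f g)) :=
  (((ContinuousMap.continuous_precomp fstPt).tendsto f).comp hu).mul
    (((ContinuousMap.continuous_precomp sndPt).tendsto g).comp hv)

/-- The family of derivatives of a product of smooth functions. -/
def mulFamily (f : CInfty K₁) (g : CInfty K₂) (w : Word (ι₁ ⊕ ι₂)) : C(prodCompacts K₁ K₂, ℝ) :=
  funMul (f.1 (word (leftPart w.1))) (g.1 (word (rightPart w.1)))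

lemma mulFamily_mem (f : CInfty K₁) (g : CInfty K₂) :
    mulFamily f g ∈ CSpace (⊤ : ℕ∞) (prodCompacts K₁ K₂) := by
  refine mem_cInfty_of_hasFDerivAt fun w z hz => ?_
  have hz' := hz
  rw [interior_prodCompacts] at hz'
  have hx : z ∘ Sum.inl ∈ interior (K₁ : Set (ι₁ → ℝ)) := hz'.1
  have hy : z ∘ Sum.inr ∈ interior (K₂ : Set (ι₂ → ℝ)) := hz'.2
  let A : (ι₁ ⊕ ι₂ → ℝ) →L[ℝ] (ι₁ → ℝ) :=
    ContinuousLinearMap.pi fun i => ContinuousLinearMap.proj (Sum.inl i)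
  let B : (ι₁ ⊕ ι₂ → ℝ) →L[ℝ] (ι₂ → ℝ) :=
    ContinuousLinearMap.pi fun j => ContinuousLinearMap.proj (Sum.inr j)
  have hf := (hasFDerivAt_of_mem f (leftPart w) hx).comp z (A.hasFDerivAt (x := z))
  have hg := (hasFDerivAt_of_mem g (rightPart w) hy).comp z (B.hasFDerivAt (x := z))
  have heq : extendZero (prodCompacts K₁ K₂) (mulFamily f g (word w)) =ᶠ[𝓝 z]
      fun u => (extendZero K₁ (f.1 (word (leftPart w))) ∘ A) u *
        (extendZero K₂ (g.1 (word (rightPart w))) ∘ B) u := by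
    filter_upwards [isOpen_interior.mem_nhds hz] with u hu
    have hu' := interior_mem hu
    rw [extendZero_of_mem _ hu']
    change _ = extendZero K₁ _ (u ∘ Sum.inl) * extendZero K₂ _ (u ∘ Sum.inr)
    rw [extendZero_of_mem _ hu'.1, extendZero_of_mem _ hu'.2]
    rfl
  have h := (hf.mul hg).congr_of_eventuallyEq heq
  convert! h using 1
  ext v
  have e1 : extendZero K₁ (f.1 (word (leftPart w))) (A z) =
      f.1 (word (leftPart w)) ⟨z ∘ Sum.inl, interior_mem hx⟩ :=
    extendZero_of_mem (x := z ∘ Sum.inl) _ (interior_mem hx)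
  have e2 : extendZero K₂ (g.1 (word (rightPart w))) (B z) =
      g.1 (word (rightPart w)) ⟨z ∘ Sum.inr, interior_mem hy⟩ :=
    extendZero_of_mem (x := z ∘ Sum.inr) _ (interior_mem hy)
  simp only [add_apply, smul_apply, ContinuousLinearMap.comp_apply, Function.comp_apply, e1, e2,
    formOf_apply, Fintype.sum_sum_type, smul_eq_mul]
  rw [add_comm, Finset.mul_sum, Finset.mul_sum]
  congr 1
  · refine Finset.sum_congr rfl fun j _ => ?_
    rw [← mul_assoc]
    rfl
  · refine Finset.sum_congr rfl fun i _ => ?_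
    rw [← mul_assoc, mul_comm (g.1 _ _)]
    rfl

/-- The product `(x, y) ↦ f(x) g(y)` of smooth functions. -/
def smoothMul : CInfty K₁ →ₗ[ℝ] CInfty K₂ →ₗ[ℝ] CInfty (prodCompacts K₁ K₂) :=
  LinearMap.mk₂ ℝ (fun f g => ⟨mulFamily f g, mulFamily_mem f g⟩)
    (fun f f' g => by ext w z; exact add_mul _ _ _)
    (fun c f g => by ext w z; exact mul_assoc _ _ _)
    (fun f g g' => by ext w z; exact mul_add _ _ _)
    (fun c f g => by ext w z; exact mul_left_comm _ _ _)

lemma polyC_polyMul (p : MvPolynomial ι₁ ℝ) (q : MvPolynomial ι₂ ℝ) :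
    polyC (prodCompacts K₁ K₂) (polyMul p q) = smoothMul (polyC K₁ p) (polyC K₂ q) := by
  refine Subtype.ext (funext fun w => ?_)
  change polyOn _ (polyDeriv w.1 (polyMul p q)) = _
  rw [polyDeriv_polyMul, polyOn_polyMul]
  rfl

lemma isProductFunction_iff (h₁ : IsFat K₁) (h₂ : IsFat K₂) {f : CInfty K₁} {g : CInfty K₂}
    {h : CInfty (prodCompacts K₁ K₂)} : IsProductFunction f g h ↔ h = smoothMul f g := by
  constructor
  · intro H
    refine toFn_injective (h₁.prodCompacts h₂) ?_
    ext z
    exact H z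
  · rintro rfl z
    rfl

lemma isTensor_iff (h₁ : IsFat K₁) (h₂ : IsFat K₂) {μ : CInfty K₁ →L[ℝ] ℝ}
    {ν : CInfty K₂ →L[ℝ] ℝ} {l : CInfty (prodCompacts K₁ K₂) →L[ℝ] ℝ} :
    IsTensor μ ν l ↔ ∀ f g, l (smoothMul f g) = μ f * ν g := by
  simp only [IsTensor, isProductFunction_iff h₁ h₂]
  exact ⟨fun H f g => H f g _ rfl, fun H f g h hh => by rw [hh, H]⟩

lemma tendsto_smoothMul {u : ℕ → CInfty K₁} {v : ℕ → CInfty K₂} {f : CInfty K₁} {g : CInfty K₂}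
    (hu : Tendsto u atTop (𝓝 f)) (hv : Tendsto v atTop (𝓝 g)) :
    Tendsto (fun n => smoothMul (u n) (v n)) atTop (𝓝 (smoothMul f g)) :=
  tendsto_cInfty_iff.2 fun w => tendsto_funMul (tendsto_cInfty_iff.1 hu (leftPart w))
    (tendsto_cInfty_iff.1 hv (rightPart w))

/-- Contracting with an evaluation is restriction to the slice at `y`, so the supremum is over fewer
points. -/
lemma norm_polyOn_contractRight_le (r : MvPolynomial (ι₁ ⊕ ι₂) ℝ) (y : K₂) :
    ‖polyOn K₁ (contractRight (evalₗ (y : ι₂ → ℝ)) r)‖ ≤ ‖polyOn (prodCompacts K₁ K₂) r‖ := by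
  refine (ContinuousMap.norm_le _ (norm_nonneg _)).2 fun x => ?_
  rw [polyOn_apply, eval_contractRight_eval]
  exact (polyOn (prodCompacts K₁ K₂) r).norm_coe_le_norm (pairPt x y)

lemma norm_polyOn_contractLeft_le (r : MvPolynomial (ι₁ ⊕ ι₂) ℝ) (x : K₁) :
    ‖polyOn K₂ (contractLeft (evalₗ (x : ι₁ → ℝ)) r)‖ ≤ ‖polyOn (prodCompacts K₁ K₂) r‖ := by
  refine (ContinuousMap.norm_le _ (norm_nonneg _)).2 fun y => ?_
  rw [polyOn_apply, eval_contractLeft_eval]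
  exact (polyOn (prodCompacts K₁ K₂) r).norm_coe_le_norm (pairPt x y)

lemma polyOn_contractLeft_apply (μ : CInfty K₁ →L[ℝ] ℝ) (r : MvPolynomial (ι₁ ⊕ ι₂) ℝ) (y : K₂) :
    polyOn K₂ (contractLeft ((μ : CInfty K₁ →ₗ[ℝ] ℝ) ∘ₗ polyC K₁) r) y =
      μ (polyC K₁ (contractRight (evalₗ (y : ι₂ → ℝ)) r)) :=
  eval_contractLeft _ r y

end ProductSpace

/-! ### Markov's inequality with natural exponents. -/

section Markov

variable {ι : Type*} [Fintype ι] [DecidableEq ι]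

/-- Markov's inequality for first derivatives of polynomials of degree at most `d`. -/
def MarkovBound (K : Compacts (ι → ℝ)) (M : ℝ) (k : ℕ) : Prop :=
  ∀ d : ℕ, 1 ≤ d → ∀ p : MvPolynomial ι ℝ, p.totalDegree ≤ d → ∀ i,
    ‖polyOn K (MvPolynomial.pderiv i p)‖ ≤ M * (d : ℝ) ^ k * ‖polyOn K p‖

lemma SatisfiesMarkov.exists_markovBound {K : Compacts (ι → ℝ)} {r : ℝ}
    (h : SatisfiesMarkov K r) : ∃ (M : ℝ) (k : ℕ), 0 ≤ M ∧ MarkovBound K M k := by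
  obtain ⟨M, hM, h⟩ := h
  refine ⟨M, ⌈max r 0⌉₊, hM.le, fun d hd p hp i => ?_⟩
  refine (h [i] p).trans ?_
  have hd' : (1 : ℝ) ≤ d := by exact_mod_cast hd
  gcongr
  rw [List.length_singleton, Nat.cast_one, mul_one]
  have hr : r ≤ (⌈max r 0⌉₊ : ℕ) := (le_max_left _ _).trans (Nat.le_ceil _)
  -- Degree zero is separate because powers of `0` are not monotone in the exponent; there `0 ^ r ≤
  -- 1` suffices.
  rcases Nat.eq_zero_or_pos p.totalDegree with h0 | h0
  · rw [h0, Nat.cast_zero]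
    refine le_trans ?_ (one_le_pow₀ hd')
    exact Real.zero_rpow_le_one r
  · rw [← Real.rpow_natCast]
    refine (Real.rpow_le_rpow_of_exponent_le (by exact_mod_cast h0) hr).trans ?_
    exact Real.rpow_le_rpow (by positivity) (by exact_mod_cast hp) (by positivity)

lemma MarkovBound.mono {K : Compacts (ι → ℝ)} {M M' : ℝ} {k k' : ℕ} (h : MarkovBound K M k)
    (hM : M ≤ M') (hM' : 0 ≤ M') (hk : k ≤ k') : MarkovBound K M' k' := by
  intro d hd p hp i
  refine (h d hd p hp i).trans ?_
  have hd' : (1 : ℝ) ≤ d := by exact_mod_cast hd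
  gcongr

lemma totalDegree_polyDeriv_le (w : List ι) (p : MvPolynomial ι ℝ) :
    (polyDeriv w p).totalDegree ≤ p.totalDegree := by
  induction w with
  | nil => exact le_rfl
  | cons i w ih => exact (totalDegree_pderiv_le i _).trans ih

/-- Differentiation does not raise the degree, so the first-order inequality can be iterated with
the same `d`. -/
lemma MarkovBound.polyDeriv_le {K : Compacts (ι → ℝ)} {M : ℝ} {k : ℕ} (h : MarkovBound K M k)
    (hM : 0 ≤ M) {d : ℕ} (hd : 1 ≤ d) {p : MvPolynomial ι ℝ} (hp : p.totalDegree ≤ d)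
    (w : List ι) : ‖polyOn K (polyDeriv w p)‖ ≤
      M ^ w.length * (d : ℝ) ^ (k * w.length) * ‖polyOn K p‖ := by
  induction w with
  | nil => simp [polyDeriv]
  | cons i w ih =>
    rw [polyDeriv_cons]
    refine (h d hd _ ((totalDegree_polyDeriv_le w p).trans hp) i).trans ?_
    calc _ ≤ M * (d : ℝ) ^ k * (M ^ w.length * (d : ℝ) ^ (k * w.length) * ‖polyOn K p‖) := by
          gcongr
      _ = _ := by
          rw [List.length_cons]
          ring

end Markov

/-! ### Markov's inequality on a product set. -/

section MarkovProduct

variable {ι₁ ι₂ : Type*} [Fintype ι₁] [DecidableEq ι₁] [Fintype ι₂] [DecidableEq ι₂]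
  {K₁ : Compacts (ι₁ → ℝ)} {K₂ : Compacts (ι₂ → ℝ)}

/-- A first partial derivative involves one group of variables only. Freezing the other group gives
a polynomial on one factor, of no larger degree and no larger sup norm. -/
lemma MarkovBound.prodCompacts {M : ℝ} {k : ℕ} (hM : 0 ≤ M) (h₁ : MarkovBound K₁ M k)
    (h₂ : MarkovBound K₂ M k) : MarkovBound (prodCompacts K₁ K₂) M k := by
  intro d hd p hp i
  refine (ContinuousMap.norm_le _ (by positivity)).2 fun z => ?_
  obtain ⟨x, y, rfl⟩ : ∃ x y, z = pairPt x y := ⟨_, _, (pairPt_fst_snd z).symm⟩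
  rcases i with i | j
  · have h := h₁ d hd _ ((totalDegree_contractRight_le (evalₗ (y : ι₂ → ℝ)) p).trans hp) i
    have e : polyOn (NewtonProduct.prodCompacts K₁ K₂) (MvPolynomial.pderiv (Sum.inl i) p)
        (pairPt x y) =
        polyOn K₁ (MvPolynomial.pderiv i (contractRight (evalₗ (y : ι₂ → ℝ)) p)) x := by
      rw [pderiv_contractRight, polyOn_apply, polyOn_apply, eval_contractRight_eval]
      rfl
    rw [e]
    refine (ContinuousMap.norm_coe_le_norm _ x).trans (h.trans ?_)
    gcongr
    exact norm_polyOn_contractRight_le p y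
  · have h := h₂ d hd _ ((totalDegree_contractLeft_le (evalₗ (x : ι₁ → ℝ)) p).trans hp) j
    have e : polyOn (NewtonProduct.prodCompacts K₁ K₂) (MvPolynomial.pderiv (Sum.inr j) p)
        (pairPt x y) =
        polyOn K₂ (MvPolynomial.pderiv j (contractLeft (evalₗ (x : ι₁ → ℝ)) p)) y := by
      rw [pderiv_contractLeft, polyOn_apply, polyOn_apply, eval_contractLeft_eval]
      rfl
    rw [e]
    refine (ContinuousMap.norm_coe_le_norm _ y).trans (h.trans ?_)
    gcongr
    exact norm_polyOn_contractLeft_le p x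

end MarkovProduct

/-! ### Density of polynomials and extension of linear forms. -/

section Density

variable {ι : Type*} [Fintype ι] [DecidableEq ι] {K : Compacts (ι → ℝ)}

/-- The derivative along a word as a continuous linear map. -/
def derivL (K : Compacts (ι → ℝ)) (w : List ι) : CInfty K →L[ℝ] C(K, ℝ) :=
  (ContinuousLinearMap.proj (word w)).comp (CSpace (⊤ : ℕ∞) K).subtypeL

/-- Every smooth function is the limit of a sequence of polynomials. -/
def PolyDense (K : Compacts (ι → ℝ)) : Prop :=
  ∀ f : CInfty K, ∃ p : ℕ → MvPolynomial ι ℝ, Tendsto (fun n => polyC K (p n)) atTop (𝓝 f)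

lemma NewtonSequence.Converging.polyDense (hK : IsFat K) {N : NewtonSequence K}
    (hN : N.Converging) : PolyDense K := by
  intro f
  have h : ∀ n, ∃ p : MvPolynomial ι ℝ, N.proj n f = polyC K p := fun n =>
    let ⟨p, _, hp⟩ := (isPolyOfDegreeLE_iff hK).1 ((N.isProjector n).1 f)
    ⟨p, hp⟩
  choose p hp using h
  exact ⟨p, by simpa only [hp] using hN f⟩

/-- Continuous linear maps that agree on polynomials are equal. -/
lemma PolyDense.ext_polyC (hK : PolyDense K) {E : Type*} [AddCommGroup E] [Module ℝ E]
    [TopologicalSpace E] [T2Space E] {l l' : CInfty K →L[ℝ] E}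
    (h : ∀ p, l (polyC K p) = l' (polyC K p)) : l = l' := by
  ext f
  obtain ⟨p, hp⟩ := hK f
  have h1 := (l.continuous.tendsto f).comp hp
  have h2 := (l'.continuous.tendsto f).comp hp
  refine tendsto_nhds_unique h1 (h2.congr fun n => (h (p n)).symm)

lemma exists_rightInverse_range {E F : Type*} [AddCommGroup E] [Module ℝ E] [AddCommGroup F]
    [Module ℝ F] (e : E →ₗ[ℝ] F) : ∃ g : LinearMap.range e →ₗ[ℝ] E, ∀ x, e (g x) = x := by
  obtain ⟨g, hg⟩ := e.rangeRestrict.exists_rightInverse_of_surjective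
    (LinearMap.range_rangeRestrict e)
  exact ⟨g, fun x => congrArg Subtype.val (LinearMap.congr_fun hg x)⟩

/-- A linear form on polynomials that is bounded by the sup norms of finitely many derivatives
extends to a continuous linear form on smooth functions. -/
lemma exists_extension_of_bound {κ : Type*} [Fintype κ] (W : κ → List ι)
    (T : MvPolynomial ι ℝ →ₗ[ℝ] ℝ) (C : ℝ)
    (h : ∀ r, |T r| ≤ C * ∑ k, ‖polyOn K (polyDeriv (W k) r)‖) :
    ∃ l : CInfty K →L[ℝ] ℝ, ∀ r, l (polyC K r) = T r := by
  have hC : ∀ r, |T r| ≤ |C| * ∑ k, ‖polyOn K (polyDeriv (W k) r)‖ := fun r =>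
    (h r).trans (mul_le_mul_of_nonneg_right (le_abs_self C)
      (Finset.sum_nonneg fun _ _ => norm_nonneg _))
  -- Recording the finitely many relevant derivatives places the problem in a normed space, where
  -- Hahn-Banach applies.
  let Φ : CInfty K →L[ℝ] (κ → C(K, ℝ)) := ContinuousLinearMap.pi fun k => derivL K (W k)
  let e : MvPolynomial ι ℝ →ₗ[ℝ] (κ → C(K, ℝ)) := (Φ : CInfty K →ₗ[ℝ] _) ∘ₗ polyC K
  have he : ∀ r k, e r k = polyOn K (polyDeriv (W k) r) := fun r k => rfl
  obtain ⟨g, hg'⟩ := exists_rightInverse_range e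
  -- By the bound, `T` vanishes on the kernel of `e`, so it descends to the range and the choice of
  -- `g` is immaterial.
  have hT : ∀ r, T (g (e.rangeRestrict r)) = T r := by
    intro r
    rw [← sub_eq_zero, ← map_sub, ← abs_nonpos_iff]
    refine (hC _).trans (le_of_eq ?_)
    have h0 : e (g (e.rangeRestrict r) - r) = 0 := by
      rw [map_sub, hg', sub_eq_zero]
      rfl
    simp only [← he, h0, Pi.zero_apply, norm_zero, Finset.sum_const_zero, mul_zero]
  let t : LinearMap.range e →L[ℝ] ℝ := (T ∘ₗ g).mkContinuous (|C| * Fintype.card κ) fun x => by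
    rw [LinearMap.comp_apply, Real.norm_eq_abs, mul_assoc]
    refine (hC _).trans ?_
    gcongr
    simp only [← he, hg']
    calc ∑ k, ‖(x : κ → C(K, ℝ)) k‖ ≤ ∑ _k : κ, ‖x‖ :=
          Finset.sum_le_sum fun k _ => norm_le_pi_norm (x : κ → C(K, ℝ)) k
      _ = _ := by simp
  obtain ⟨t', ht', -⟩ := exists_extension_norm_eq (LinearMap.range e) t
  refine ⟨t'.comp Φ, fun r => ?_⟩
  exact (ht' (e.rangeRestrict r)).trans (hT r)

end Density

/-! ### Tensor products of continuous linear forms. -/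

section Tensor

variable {ι₁ ι₂ : Type*} [Fintype ι₁] [DecidableEq ι₁] [Fintype ι₂] [DecidableEq ι₂]
  {K₁ : Compacts (ι₁ → ℝ)} {K₂ : Compacts (ι₂ → ℝ)}

/-- The tensor product of two linear forms, on polynomials. -/
def polyTensor (μ : CInfty K₁ →L[ℝ] ℝ) (ν : CInfty K₂ →L[ℝ] ℝ) :
    MvPolynomial (ι₁ ⊕ ι₂) ℝ →ₗ[ℝ] ℝ :=
  ((ν : CInfty K₂ →ₗ[ℝ] ℝ) ∘ₗ polyC K₂) ∘ₗ contractLeft ((μ : CInfty K₁ →ₗ[ℝ] ℝ) ∘ₗ polyC K₁)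

lemma polyTensor_polyMul (μ : CInfty K₁ →L[ℝ] ℝ) (ν : CInfty K₂ →L[ℝ] ℝ)
    (p : MvPolynomial ι₁ ℝ) (q : MvPolynomial ι₂ ℝ) :
    polyTensor μ ν (polyMul p q) = μ (polyC K₁ p) * ν (polyC K₂ q) := by
  simp only [polyTensor, LinearMap.comp_apply, contractLeft_polyMul, map_smul, smul_eq_mul]
  rfl

/-- The continuity estimate of `ν` is applied to the contraction by `μ`, and that of `μ` to each
slice. Contraction commutes with differentiation in the other variables, so only mixed derivatives
of `r` appear. -/
lemma exists_polyTensor_bound (μ : CInfty K₁ →L[ℝ] ℝ) (ν : CInfty K₂ →L[ℝ] ℝ) :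
    ∃ (S : Finset (List ι₁ × List ι₂)) (C : ℝ), ∀ r, |polyTensor μ ν r| ≤
      C * ∑ k : S, ‖polyOn (prodCompacts K₁ K₂)
        (polyDeriv (k.1.1.map Sum.inl ++ k.1.2.map Sum.inr) r)‖ := by
  obtain ⟨S₁, C₁, hC₁, h₁⟩ := exists_bound μ
  obtain ⟨S₂, C₂, hC₂, h₂⟩ := exists_bound ν
  refine ⟨S₁ ×ˢ S₂, C₂ * C₁, fun r => (h₂ _).trans ?_⟩
  rw [Finset.sum_coe_sort (S₁ ×ˢ S₂) fun k => ‖polyOn (prodCompacts K₁ K₂)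
        (polyDeriv (k.1.map Sum.inl ++ k.2.map Sum.inr) r)‖, Finset.sum_product_right, mul_assoc,
    Finset.mul_sum _ _ C₁]
  gcongr with v hv
  refine (ContinuousMap.norm_le _ (by positivity)).2 fun y => ?_
  rw [polyC_val, polyDeriv_contractLeft, polyOn_contractLeft_apply, Real.norm_eq_abs]
  refine (h₁ _).trans ?_
  gcongr with u hu
  rw [polyC_val, polyDeriv_contractRight, polyDeriv_append]
  exact norm_polyOn_contractRight_le _ y

/-- Existence of the tensor product of two continuous linear forms. -/
lemma exists_tensor (h₁ : PolyDense K₁) (h₂ : PolyDense K₂) (μ : CInfty K₁ →L[ℝ] ℝ)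
    (ν : CInfty K₂ →L[ℝ] ℝ) :
    ∃ l : CInfty (prodCompacts K₁ K₂) →L[ℝ] ℝ, ∀ f g, l (smoothMul f g) = μ f * ν g := by
  obtain ⟨S, C, h⟩ := exists_polyTensor_bound μ ν
  obtain ⟨l, hl⟩ := exists_extension_of_bound _ _ C h
  refine ⟨l, fun f g => ?_⟩
  obtain ⟨p, hp⟩ := h₁ f
  obtain ⟨q, hq⟩ := h₂ g
  have e1 := (l.continuous.tendsto _).comp (tendsto_smoothMul hp hq)
  have e2 := ((μ.continuous.tendsto _).comp hp).mul ((ν.continuous.tendsto _).comp hq)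
  refine tendsto_nhds_unique e1 (e2.congr fun n => ?_)
  simp only [Function.comp_apply]
  rw [← polyC_polyMul, hl, polyTensor_polyMul]

/-- Continuous linear maps that agree on products are equal. -/
lemma PolyDense.ext_smoothMul (h : PolyDense (prodCompacts K₁ K₂)) {E : Type*} [AddCommGroup E]
    [Module ℝ E] [TopologicalSpace E] [T2Space E] {l l' : CInfty (prodCompacts K₁ K₂) →L[ℝ] E}
    (hl : ∀ f g, l (smoothMul f g) = l' (smoothMul f g)) : l = l' :=
  h.ext_polyC fun p => polyMul_ext
    (f := (l : CInfty (prodCompacts K₁ K₂) →ₗ[ℝ] E) ∘ₗ polyC _)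
    (g := (l' : CInfty (prodCompacts K₁ K₂) →ₗ[ℝ] E) ∘ₗ polyC _)
    (fun p q => by
      simp only [LinearMap.comp_apply, polyC_polyMul]
      exact hl _ _) p

/-- The two-step estimate again, now with sup norms in bounded degree: neither contraction raises
the degree, so both bounds apply and their constants multiply. -/
lemma abs_tensor_polyC_le {μ : CInfty K₁ →L[ℝ] ℝ} {ν : CInfty K₂ →L[ℝ] ℝ}
    {l : CInfty (prodCompacts K₁ K₂) →L[ℝ] ℝ} (hl : ∀ f g, l (smoothMul f g) = μ f * ν g)
    {e : ℕ} {a b : ℝ} (ha : 0 ≤ a) (hb : 0 ≤ b)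
    (hμ : ∀ p : MvPolynomial ι₁ ℝ, p.totalDegree ≤ e → |μ (polyC K₁ p)| ≤ a * ‖polyOn K₁ p‖)
    (hν : ∀ p : MvPolynomial ι₂ ℝ, p.totalDegree ≤ e → |ν (polyC K₂ p)| ≤ b * ‖polyOn K₂ p‖)
    {r : MvPolynomial (ι₁ ⊕ ι₂) ℝ} (hr : r.totalDegree ≤ e) :
    |l (polyC _ r)| ≤ a * b * ‖polyOn (prodCompacts K₁ K₂) r‖ := by
  have e1 : l (polyC _ r) = polyTensor μ ν r :=
    polyMul_ext (f := (l : CInfty (prodCompacts K₁ K₂) →ₗ[ℝ] ℝ) ∘ₗ polyC _)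
      (g := polyTensor μ ν) (fun p q => by
        rw [polyTensor_polyMul, LinearMap.comp_apply, polyC_polyMul]
        exact hl _ _) r
  rw [e1]
  refine (hν _ ((totalDegree_contractLeft_le _ r).trans hr)).trans ?_
  rw [mul_comm a b, mul_assoc]
  gcongr
  refine (ContinuousMap.norm_le _ (by positivity)).2 fun y => ?_
  rw [polyOn_contractLeft_apply, Real.norm_eq_abs]
  refine (hμ _ ((totalDegree_contractRight_le _ r).trans hr)).trans ?_
  gcongr
  exact norm_polyOn_contractRight_le _ y

end Tensor

/-! ### Rapid approximation and uniform boundedness. -/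

section Approximation

variable {ι : Type*} [Fintype ι] [DecidableEq ι] {K : Compacts (ι → ℝ)}

/-- A smooth function as an element of `C^m(K)`. -/
def restrictOrder (m : ℕ) (f : CInfty K) : CSpace (m : ℕ∞) K :=
  ⟨fun w => f.1 (word w.1), f.2.1.of_le (by exact_mod_cast le_top), fun w x hx =>
    f.2.2 (word w.1) x hx⟩

/-- On a Jackson compact set a single sequence of polynomials approximates a smooth function
faster than every power of the degree. -/
lemma IsJackson.exists_rapid_approx (hK : IsJackson K) (f : CInfty K) :
    ∃ P : ℕ → MvPolynomial ι ℝ, (∀ n, (P n).totalDegree ≤ n) ∧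
      ∀ m : ℕ, ∃ M : ℝ, 0 ≤ M ∧ ∀ n : ℕ, 1 ≤ n →
        ‖toFn f - polyOn K (P n)‖ ≤ M * ((n : ℝ) ^ m)⁻¹ := by
  -- The slack `exp (-n)` is smaller than every power of `1 / n` up to a constant, so one
  -- near-optimal sequence serves all `m`.
  have h : ∀ n : ℕ, ∃ p : MvPolynomial ι ℝ, p.totalDegree ≤ n ∧ ‖toFn f - polyOn K p‖ <
      Metric.infDist (toFn f) (polyOn K '' {p | p.totalDegree ≤ n}) + Real.exp (-n) := by
    intro n
    have hne : (polyOn K '' {p : MvPolynomial ι ℝ | p.totalDegree ≤ n}).Nonempty :=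
      ⟨_, 0, by simp, rfl⟩
    obtain ⟨_, ⟨p, hp, rfl⟩, hlt⟩ :=
      (Metric.infDist_lt_iff hne).1 (lt_add_of_pos_right _ (Real.exp_pos (-n)))
    exact ⟨p, hp, by rwa [dist_eq_norm] at hlt⟩
  choose P hP hP' using h
  refine ⟨P, hP, fun m => ?_⟩
  obtain ⟨M, hM⟩ := hK m (restrictOrder m f)
  refine ⟨|M| + m.factorial, by positivity, fun n hn => ?_⟩
  have hn' : (0 : ℝ) < n := by exact_mod_cast hn
  have h1 : Metric.infDist (toFn f) (polyOn K '' {p | p.totalDegree ≤ n}) ≤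
      |M| * ((n : ℝ) ^ m)⁻¹ :=
    (hM n hn).trans (mul_le_mul_of_nonneg_right (le_abs_self M) (by positivity))
  have h2 : Real.exp (-n) ≤ m.factorial * ((n : ℝ) ^ m)⁻¹ := by
    have h3 := Real.pow_div_factorial_le_exp _ hn'.le m
    rw [Real.exp_neg, ← div_eq_mul_inv, ← inv_div]
    exact inv_anti₀ (by positivity) h3
  calc _ ≤ _ := (hP' n).le
    _ ≤ _ := by rw [add_mul]; exact add_le_add h1 h2

/-- Approximation of order `A + 2` leaves `1 / n²` after the weight is absorbed, and `1 / n² ≤ 2 (1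
/ n - 1 / (n + 1))`. The difference form makes later sums telescope. -/
lemma exists_increment_bound {f : CInfty K} {P : ℕ → MvPolynomial ι ℝ}
    (h : ∀ m : ℕ, ∃ M : ℝ, 0 ≤ M ∧ ∀ n : ℕ, 1 ≤ n →
      ‖toFn f - polyOn K (P n)‖ ≤ M * ((n : ℝ) ^ m)⁻¹) (A : ℕ) :
    ∃ B : ℝ, 0 ≤ B ∧ ∀ n : ℕ, 1 ≤ n →
      ((n + 1 : ℕ) : ℝ) ^ A * ‖polyOn K (P (n + 1) - P n)‖ ≤
        B * ((n : ℝ)⁻¹ - ((n + 1 : ℕ) : ℝ)⁻¹) := by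
  obtain ⟨M, hM, h⟩ := h (A + 2)
  refine ⟨2 ^ (A + 1) * (2 * M), by positivity, fun n hn => ?_⟩
  have hn' : (1 : ℝ) ≤ n := by exact_mod_cast hn
  have hn0 : (0 : ℝ) < n := by linarith
  have h1 : ‖polyOn K (P (n + 1) - P n)‖ ≤ 2 * M * ((n : ℝ) ^ (A + 2))⁻¹ := by
    have e : polyOn K (P (n + 1) - P n) =
        (toFn f - polyOn K (P n)) - (toFn f - polyOn K (P (n + 1))) := by
      rw [← polyOnₗ_apply, map_sub, polyOnₗ_apply, polyOnₗ_apply]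
      abel
    rw [e]
    refine (norm_sub_le _ _).trans ?_
    have h2 : M * (((n + 1 : ℕ) : ℝ) ^ (A + 2))⁻¹ ≤ M * ((n : ℝ) ^ (A + 2))⁻¹ := by
      gcongr
      exact Nat.le_succ n
    linarith [h n hn, h (n + 1) (by omega)]
  have h3 : ((n + 1 : ℕ) : ℝ) ≤ 2 * n := by push_cast; linarith
  calc _ ≤ (2 * n : ℝ) ^ A * (2 * M * ((n : ℝ) ^ (A + 2))⁻¹) := by gcongr
    _ = 2 ^ A * (2 * M) * ((n : ℝ) ^ 2)⁻¹ := by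
      field_simp
      ring
    _ ≤ 2 ^ A * (2 * M) * (2 * ((n : ℝ)⁻¹ - ((n + 1 : ℕ) : ℝ)⁻¹)) := by
      gcongr
      have e : (n : ℝ)⁻¹ - ((n + 1 : ℕ) : ℝ)⁻¹ = (n * ((n + 1 : ℕ) : ℝ))⁻¹ := by
        push_cast
        field_simp
        ring
      rw [e, ← inv_inv (2 : ℝ), ← mul_inv]
      apply inv_anti₀ (by positivity)
      nlinarith
    _ = _ := by ring

lemma norm_sub_le_of_increments {E : Type*} [SeminormedAddCommGroup E] {u : ℕ → E} {B : ℝ}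
    (hB : 0 ≤ B) {d : ℕ} (h : ∀ n, d ≤ n →
      ‖u (n + 1) - u n‖ ≤ B * ((n : ℝ)⁻¹ - ((n + 1 : ℕ) : ℝ)⁻¹)) {n : ℕ} (hn : d ≤ n) :
    ‖u n - u d‖ ≤ B * (d : ℝ)⁻¹ := by
  have key : ‖u n - u d‖ ≤ B * ((d : ℝ)⁻¹ - (n : ℝ)⁻¹) := by
    induction n, hn using Nat.le_induction with
    | base => simp
    | succ n hn ih =>
      have := norm_sub_le_norm_sub_add_norm_sub (u (n + 1)) (u n) (u d)
      linarith [h n hn]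
  refine key.trans (mul_le_mul_of_nonneg_left ?_ hB)
  have : (0 : ℝ) ≤ (n : ℝ)⁻¹ := by positivity
  linarith

/-- Markov's inequality costs a fixed power of the degree for each word, which rapid approximation
pays for: every derivative of `P n` is Cauchy in the sup norm. -/
lemma tendsto_polyC_of_rapid_approx (hK : IsFat K) {M : ℝ} {k : ℕ} (hM : 0 ≤ M)
    (hMarkov : MarkovBound K M k) {f : CInfty K} {P : ℕ → MvPolynomial ι ℝ}
    (hP : ∀ n, (P n).totalDegree ≤ n)
    (h : ∀ m : ℕ, ∃ M : ℝ, 0 ≤ M ∧ ∀ n : ℕ, 1 ≤ n →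
      ‖toFn f - polyOn K (P n)‖ ≤ M * ((n : ℝ) ^ m)⁻¹) :
    Tendsto (fun n => polyC K (P n)) atTop (𝓝 f) := by
  have hc : ∀ w : List ι, ∃ g, Tendsto (fun n => (polyC K (P n)).1 (word w)) atTop (𝓝 g) := by
    intro w
    obtain ⟨B, hB, hinc⟩ := exists_increment_bound h (k * w.length)
    refine cauchySeq_tendsto_of_complete (Metric.cauchySeq_iff'.2 fun ε hε => ?_)
    have hlim : Tendsto (fun n : ℕ => M ^ w.length * B * (n : ℝ)⁻¹) atTop (𝓝 0) := by
      simpa using (tendsto_inv_atTop_nhds_zero_nat (𝕜 := ℝ)).const_mul (M ^ w.length * B)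
    obtain ⟨N, hN, hN1⟩ := ((hlim.eventually (gt_mem_nhds hε)).and (eventually_ge_atTop 1)).exists
    refine ⟨N, fun n hn => ?_⟩
    rw [dist_eq_norm]
    refine (norm_sub_le_of_increments (u := fun n => (polyC K (P n)).1 (word w))
      (by positivity) (fun m hm => ?_) hn).trans_lt hN
    have hdeg : (P (m + 1) - P m).totalDegree ≤ m + 1 :=
      (MvPolynomial.totalDegree_sub _ _).trans
        (max_le (hP (m + 1)) ((hP m).trans (Nat.le_succ m)))
    have e : (polyC K (P (m + 1))).1 (word w) - (polyC K (P m)).1 (word w) =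
        polyOn K (polyDeriv w (P (m + 1) - P m)) := by
      rw [← polyC_val, map_sub]
      rfl
    rw [e]
    refine (hMarkov.polyDeriv_le hM (by omega) hdeg w).trans ?_
    rw [mul_assoc, mul_assoc]
    exact mul_le_mul_of_nonneg_left (hinc m (hN1.trans hm)) (by positivity)
  choose g hg using hc
  refine tendsto_of_family hK (g := fun w => g w.1) hg ?_
  refine tendsto_nhds_unique ?_ (hg [])
  obtain ⟨M', -, h1⟩ := h 1
  rw [tendsto_iff_norm_sub_tendsto_zero]
  have hlim : Tendsto (fun n : ℕ => M' * ((n : ℝ) ^ 1)⁻¹) atTop (𝓝 0) := by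
    simpa using (tendsto_inv_atTop_nhds_zero_nat (𝕜 := ℝ)).const_mul M'
  refine squeeze_zero' (Eventually.of_forall fun n => norm_nonneg _) ?_ hlim
  filter_upwards [eventually_ge_atTop 1] with n hn
  rw [norm_sub_rev]
  exact h1 n hn

lemma IsJackson.polyDense (hJ : IsJackson K) (hK : IsFat K) {M : ℝ} {k : ℕ} (hM : 0 ≤ M)
    (hMarkov : MarkovBound K M k) : PolyDense K := fun f =>
  let ⟨P, hP, h⟩ := hJ.exists_rapid_approx f
  ⟨P, tendsto_polyC_of_rapid_approx hK hM hMarkov hP h⟩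

/-- Uniform boundedness of pointwise bounded sequences of operators. -/
lemma exists_uniform_bound (T : ℕ → CInfty K →L[ℝ] CInfty K)
    (h : ∀ f, ∃ B, ∀ n, ‖toFn (T n f)‖ ≤ B) :
    ∃ (S : Finset (List ι)) (C : ℝ), 0 ≤ C ∧
      ∀ n f, ‖toFn (T n f)‖ ≤ C * ∑ w ∈ S, ‖f.1 (word w)‖ := by
  let q : ℕ → Seminorm ℝ (CInfty K) := fun n =>
    (normSeminorm ℝ C(K, ℝ)).comp (((derivL K []).comp (T n) : CInfty K →L[ℝ] C(K, ℝ)) :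
      CInfty K →ₗ[ℝ] C(K, ℝ))
  have hq : ∀ n, Continuous (q n) := fun n =>
    continuous_norm.comp ((derivL K []).comp (T n)).continuous
  have hb : BddAbove (Set.range q) := by
    rw [Seminorm.bddAbove_range_iff]
    intro f
    obtain ⟨B, hB⟩ := h f
    exact ⟨B, by rintro _ ⟨n, rfl⟩; exact hB n⟩
  have hcont := Seminorm.continuous_iSup q hq hb
  rw [← Seminorm.coe_iSup_eq hb] at hcont
  obtain ⟨S, C, hC, hS⟩ := exists_bound_of_continuous_seminorm _ hcont
  exact ⟨S, C, hC, fun n f => (le_ciSup hb n f).trans (hS f)⟩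

/-- Equicontinuity bounds `T n` by finitely many derivatives independent of `n`; on polynomials
these cost only powers of the degree. -/
lemma MarkovBound.exists_uniform_bound {M : ℝ} {k : ℕ} (hM : 0 ≤ M)
    (hMarkov : MarkovBound K M k) (T : ℕ → CInfty K →L[ℝ] CInfty K)
    (h : ∀ f, ∃ B, ∀ n, ‖toFn (T n f)‖ ≤ B) :
    ∃ (C : ℝ) (A : ℕ), 0 ≤ C ∧ ∀ n e, 1 ≤ e → ∀ p : MvPolynomial ι ℝ, p.totalDegree ≤ e →
      ‖toFn (T n (polyC K p))‖ ≤ C * (e : ℝ) ^ A * ‖polyOn K p‖ := by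
  obtain ⟨S, C, hC, hS⟩ := NewtonProduct.exists_uniform_bound T h
  -- The sum of the exponents stands in for their maximum.
  refine ⟨C * ∑ w ∈ S, M ^ w.length, ∑ w ∈ S, k * w.length, by positivity,
    fun n e he p hp => (hS n _).trans ?_⟩
  rw [mul_assoc, mul_assoc, Finset.sum_mul]
  gcongr with w hw
  refine (hMarkov.polyDeriv_le hM he hp w).trans ?_
  rw [mul_assoc]
  have he' : (1 : ℝ) ≤ e := by exact_mod_cast he
  gcongr
  exact Finset.single_le_sum (f := fun w : List ι => k * w.length) (fun _ _ => Nat.zero_le _) hw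

end Approximation

/-! ### Operators with polynomial values. -/

section FiniteRank

/-- Coordinates of an operator with values in a finite-dimensional subspace. -/
lemma exists_coordinates {E : Type*} [AddCommGroup E] [Module ℝ E] [TopologicalSpace E]
    [T2Space E] [IsTopologicalAddGroup E] [ContinuousSMul ℝ E] (V : Submodule ℝ E)
    [FiniteDimensional ℝ V] (T : E →L[ℝ] E) (hT : ∀ f, T f ∈ V) :
    ∃ (n : ℕ) (v : Fin n → V) (μ : Fin n → E →L[ℝ] ℝ),
      (∀ f, T f = ∑ a, μ a f • (v a : E)) ∧ ∀ a f g, T f = T g → μ a f = μ a g := by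
  let b := Module.finBasis ℝ V
  let T' : E →L[ℝ] V := T.codRestrict _ hT
  refine ⟨_, b, fun a => (LinearMap.toContinuousLinearMap (b.coord a)).comp T',
    fun f => ?_, fun a f g h => ?_⟩
  · have h := congrArg Subtype.val (b.sum_repr (T' f))
    rw [Submodule.coe_sum] at h
    exact h.symm
  · have h' : T' f = T' g := Subtype.ext h
    simp only [ContinuousLinearMap.comp_apply, h']

variable {ι : Type*} [Fintype ι] [DecidableEq ι] {K : Compacts (ι → ℝ)}

/-- The polynomials of degree at most `d` as a subspace of `C^∞(K)`. -/
def polySub (K : Compacts (ι → ℝ)) (d : ℕ) : Submodule ℝ (CInfty K) :=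
  (MvPolynomial.restrictTotalDegree ι ℝ d).map (polyC K)

lemma mem_polySub {d : ℕ} {f : CInfty K} :
    f ∈ polySub K d ↔ ∃ p : MvPolynomial ι ℝ, p.totalDegree ≤ d ∧ f = polyC K p := by
  simp only [polySub, Submodule.mem_map, MvPolynomial.mem_restrictTotalDegree, eq_comm]

lemma isPolyOfDegreeLE_iff_mem (hK : IsFat K) {d : ℕ} {f : CInfty K} :
    IsPolyOfDegreeLE d f ↔ f ∈ polySub K d := by
  rw [isPolyOfDegreeLE_iff hK, mem_polySub]

instance (d : ℕ) : FiniteDimensional ℝ (polySub K d) := by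
  unfold polySub
  infer_instance

/-- The value of the derivative along `w` at `x` as a continuous linear form. -/
def evalDeriv (w : List ι) (x : K) : CInfty K →L[ℝ] ℝ :=
  (ContinuousMap.evalCLM ℝ x).comp (derivL K w)

lemma eq_of_forall_form {f g : CInfty K} (h : ∀ l : CInfty K →L[ℝ] ℝ, l f = l g) : f = g := by
  ext w x
  exact h (evalDeriv w.1 x)

/-- An operator with values in the polynomials of degree at most `d` has finite rank. -/
lemma exists_finiteRank (T : CInfty K →L[ℝ] CInfty K) (d : ℕ) (hT : ∀ f, T f ∈ polySub K d) :
    ∃ (n : ℕ) (u : Fin n → MvPolynomial ι ℝ) (μ : Fin n → CInfty K →L[ℝ] ℝ),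
      (∀ a, (u a).totalDegree ≤ d) ∧ (∀ f, T f = ∑ a, μ a f • polyC K (u a)) ∧
      ∀ a f g, T f = T g → μ a f = μ a g := by
  obtain ⟨n, v, μ, hv, hμ⟩ := exists_coordinates (polySub K d) T hT
  have hb : ∀ a, ∃ p : MvPolynomial ι ℝ, p.totalDegree ≤ d ∧ (v a : CInfty K) = polyC K p :=
    fun a => mem_polySub.1 (v a).2
  choose u hu hu' using hb
  exact ⟨n, u, μ, hu, by simpa only [hu'] using hv, hμ⟩

end FiniteRank

/-! ### Conditions and increments of Newton sequences. -/

section Increments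

variable {ι : Type*} [Fintype ι] [DecidableEq ι] {K : Compacts (ι → ℝ)}

lemma IsPolynomialProjector.idem {d : ℕ} {P : CInfty K →L[ℝ] CInfty K}
    (hP : IsPolynomialProjector d P) (f : CInfty K) : P (P f) = P f := hP.2 _ (hP.1 f)

lemma IsPolynomialProjector.apply_polyC {d : ℕ} {P : CInfty K →L[ℝ] CInfty K}
    (hP : IsPolynomialProjector d P) {p : MvPolynomial ι ℝ} (hp : p.totalDegree ≤ d) :
    P (polyC K p) = polyC K p := hP.2 _ ⟨p, hp, rfl⟩

lemma comp_mem_interpConditions {d : ℕ} {P : CInfty K →L[ℝ] CInfty K}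
    (hP : IsPolynomialProjector d P) (l : CInfty K →L[ℝ] ℝ) :
    l.comp P ∈ interpConditions P := fun f => by
  simp only [ContinuousLinearMap.comp_apply, hP.idem]

/-- A projector is determined by its degree and its interpolation conditions. -/
lemma IsPolynomialProjector.eq_of_interpConditions {d : ℕ} {P Q : CInfty K →L[ℝ] CInfty K}
    (hP : IsPolynomialProjector d P) (hQ : IsPolynomialProjector d Q)
    (h : interpConditions P ≤ interpConditions Q) : P = Q := by
  ext1 f
  refine eq_of_forall_form fun l => ?_
  -- The form `l ∘ P` is a condition of `P`, hence of `Q`; moreover `P` fixes `Q f`, a polynomial of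
  -- degree at most `d`.
  have h1 : l (P f) = l (P (Q f)) := h (comp_mem_interpConditions hP l) f
  rw [h1, hP.2 _ (hQ.1 f)]

namespace NewtonSequence

variable (N : NewtonSequence K)

lemma interpConditions_mono : Monotone fun d => interpConditions (N.proj d) :=
  monotone_nat_of_le_succ N.nested

/-- For every form `l`, the form `l ∘ Π_i` is a condition of `Π_i`, hence of `Π_j` by nesting, and
such forms separate the two sides. -/
lemma proj_comp_of_le {i j : ℕ} (h : i ≤ j) (f : CInfty K) :
    N.proj i (N.proj j f) = N.proj i f := by
  refine eq_of_forall_form fun l => ?_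
  exact (N.interpConditions_mono h (comp_mem_interpConditions (N.isProjector i) l) f).symm

/-- The difference of consecutive projectors. -/
def increment : ℕ → CInfty K →L[ℝ] CInfty K
  | 0 => N.proj 0
  | k + 1 => N.proj (k + 1) - N.proj k

lemma sum_increment (d : ℕ) (f : CInfty K) :
    ∑ k ∈ Finset.range (d + 1), N.increment k f = N.proj d f := by
  induction d with
  | zero => simp [increment]
  | succ d ih =>
    rw [Finset.sum_range_succ, ih]
    simp [increment]

lemma increment_proj (k : ℕ) (f : CInfty K) : N.increment k (N.proj k f) = N.increment k f := by
  cases k with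
  | zero => exact (N.isProjector 0).idem f
  | succ k =>
    simp only [increment, sub_apply]
    rw [(N.isProjector (k + 1)).idem, N.proj_comp_of_le (Nat.le_succ k)]

/-- Both `Π_k f` and `Π_{k-1} f` satisfy the condition `μ`, so their difference is invisible to it.
This is the dual of `increment_polyC_eq_zero`. -/
lemma form_increment_eq_zero {i k : ℕ} (h : i < k) {μ : CInfty K →L[ℝ] ℝ}
    (hμ : μ ∈ interpConditions (N.proj i)) (f : CInfty K) : μ (N.increment k f) = 0 := by
  obtain ⟨k, rfl⟩ : ∃ k', k = k' + 1 := ⟨k - 1, by omega⟩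
  have h1 := N.interpConditions_mono (by omega : i ≤ k) hμ f
  have h2 := N.interpConditions_mono (by omega : i ≤ k + 1) hμ f
  simp only [increment, sub_apply, map_sub]
  rw [← h1, ← h2, sub_self]

lemma increment_polyC_eq_zero {a k : ℕ} (h : a < k) {p : MvPolynomial ι ℝ}
    (hp : p.totalDegree ≤ a) : N.increment k (polyC K p) = 0 := by
  obtain ⟨k, rfl⟩ : ∃ k', k = k' + 1 := ⟨k - 1, by omega⟩
  simp only [increment, sub_apply]
  rw [(N.isProjector _).apply_polyC (by omega), (N.isProjector _).apply_polyC (by omega), sub_self]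

lemma increment_mem_polySub (hK : IsFat K) (k : ℕ) (f : CInfty K) :
    N.increment k f ∈ polySub K k := by
  have h : ∀ n, N.proj n f ∈ polySub K n := fun n =>
    (isPolyOfDegreeLE_iff_mem hK).1 ((N.isProjector n).1 f)
  cases k with
  | zero => exact h 0
  | succ k =>
    refine Submodule.sub_mem _ (h (k + 1)) ?_
    obtain ⟨p, hp, hp'⟩ := mem_polySub.1 (h k)
    exact mem_polySub.2 ⟨p, hp.trans (Nat.le_succ k), hp'⟩

variable {N}

lemma Converging.exists_bound (hN : N.Converging) (f : CInfty K) :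
    ∃ B, ∀ n, ‖toFn (N.proj n f)‖ ≤ B := by
  have h := ((tendsto_cInfty_iff.1 (hN f) []).norm).bddAbove_range
  obtain ⟨B, hB⟩ := h
  exact ⟨B, fun n => hB ⟨n, rfl⟩⟩

lemma Converging.exists_bound_increment (hN : N.Converging) (f : CInfty K) :
    ∃ B, ∀ n, ‖toFn (N.increment n f)‖ ≤ B := by
  obtain ⟨B, hB⟩ := hN.exists_bound f
  refine ⟨B + B, fun n => ?_⟩
  cases n with
  | zero => exact (hB 0).trans (le_add_of_nonneg_left ((norm_nonneg _).trans (hB 0)))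
  | succ n => exact (norm_sub_le _ _).trans (add_le_add (hB (n + 1)) (hB n))

end NewtonSequence

end Increments

/-! ### The projectors of the Newton product and their growth. -/

section Product

variable {ι₁ ι₂ : Type*} [Fintype ι₁] [DecidableEq ι₁] [Fintype ι₂] [DecidableEq ι₂]
  {K₁ : Compacts (ι₁ → ℝ)} {K₂ : Compacts (ι₂ → ℝ)}

/-- The tensor product of two operators with polynomial values. -/
lemma exists_tensor_operator (hK₁ : IsFat K₁) (hK₂ : IsFat K₂) (h₁ : PolyDense K₁)
    (h₂ : PolyDense K₂) {A : CInfty K₁ →L[ℝ] CInfty K₁} {B : CInfty K₂ →L[ℝ] CInfty K₂} {i j : ℕ}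
    (hA : ∀ f, A f ∈ polySub K₁ i) (hB : ∀ f, B f ∈ polySub K₂ j) :
    ∃ T : CInfty (prodCompacts K₁ K₂) →L[ℝ] CInfty (prodCompacts K₁ K₂),
      (∀ f g, T (smoothMul f g) = smoothMul (A f) (B g)) ∧
      (∀ F, T F ∈ polySub _ (i + j)) ∧
      ∀ l : CInfty (prodCompacts K₁ K₂) →L[ℝ] ℝ, l.comp T ∈ Submodule.span ℝ
        {l' | ∃ μ : CInfty K₁ →L[ℝ] ℝ, (∀ f g, A f = A g → μ f = μ g) ∧
          ∃ ν : CInfty K₂ →L[ℝ] ℝ, (∀ f g, B f = B g → ν f = ν g) ∧ IsTensor μ ν l'} := by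
  obtain ⟨m, u, μ, hu, hAμ, hμ⟩ := exists_finiteRank A i hA
  obtain ⟨n, v, ν, hv, hBν, hν⟩ := exists_finiteRank B j hB
  choose L hL using fun a b => exists_tensor h₁ h₂ (μ a) (ν b)
  refine ⟨∑ a, ∑ b, (L a b).smulRight (polyC _ (polyMul (u a) (v b))), fun f g => ?_,
    fun F => ?_, fun l => ?_⟩
  · simp only [sum_apply, ContinuousLinearMap.smulRight_apply, hL, hAμ f, hBν g, map_sum,
      LinearMap.sum_apply, map_smul, LinearMap.smul_apply, polyC_polyMul, Finset.smul_sum,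
      smul_smul]
    rw [Finset.sum_comm]
    refine Finset.sum_congr rfl fun b _ => Finset.sum_congr rfl fun a _ => ?_
    rw [mul_comm]
  · simp only [sum_apply, ContinuousLinearMap.smulRight_apply]
    refine Submodule.sum_mem _ fun a _ => Submodule.sum_mem _ fun b _ =>
      Submodule.smul_mem _ _ (mem_polySub.2 ⟨_, ?_, rfl⟩)
    exact (totalDegree_polyMul_le _ _).trans (add_le_add (hu a) (hv b))
  · have e : l.comp (∑ a, ∑ b, (L a b).smulRight (polyC _ (polyMul (u a) (v b)))) =
        ∑ a, ∑ b, l (polyC _ (polyMul (u a) (v b))) • L a b := by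
      ext F
      simp only [ContinuousLinearMap.comp_apply, sum_apply, ContinuousLinearMap.smulRight_apply,
        map_sum, map_smul, smul_apply, smul_eq_mul]
      exact Finset.sum_congr rfl fun a _ => Finset.sum_congr rfl fun b _ => mul_comm _ _
    rw [e]
    refine Submodule.sum_mem _ fun a _ => Submodule.sum_mem _ fun b _ =>
      Submodule.smul_mem _ _ (Submodule.subset_span ?_)
    exact ⟨μ a, hμ a, ν b, hν b, (isTensor_iff hK₁ hK₂).2 (hL a b)⟩

/-- Summation of a bilinear expression in which one factor stabilizes before the other one
becomes relevant. -/
lemma sum_bilin_eq {M₁ M₂ M₃ : Type*} [AddCommGroup M₁] [Module ℝ M₁] [AddCommGroup M₂]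
    [Module ℝ M₂] [AddCommGroup M₃] [Module ℝ M₃] (B : M₁ →ₗ[ℝ] M₂ →ₗ[ℝ] M₃) {S : ℕ → M₁}
    {U : ℕ → M₂} {x : M₁} {y : M₂} {a b d : ℕ} (hab : a + b ≤ d) (hS : ∀ k, a < k → S k = 0)
    (hx : ∑ k ∈ Finset.range (a + 1), S k = x) (hU : ∀ n, b ≤ n → U n = y) :
    ∑ k ∈ Finset.range (d + 1), B (S k) (U (d - k)) = B x y := by
  have hsub : Finset.range (a + 1) ⊆ Finset.range (d + 1) :=
    Finset.range_subset_range.2 (by omega)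
  rw [← Finset.sum_subset hsub, ← hx, map_sum, LinearMap.sum_apply]
  -- For `k ≤ a` the index satisfies `d - k ≥ b`, so the second factor has already stabilized.
  · refine Finset.sum_congr rfl fun k hk => ?_
    rw [hU _ (by have := Finset.mem_range.1 hk; omega)]
  · intro k _ hk
    rw [hS k (by simpa using hk), map_zero, LinearMap.zero_apply]

/-- The conditions of degree `d` of a Newton product. -/
def productConditions (N₁ : NewtonSequence K₁) (N₂ : NewtonSequence K₂) (d : ℕ) :
    Submodule ℝ (CInfty (prodCompacts K₁ K₂) →L[ℝ] ℝ) :=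
  Submodule.span ℝ {l | ∃ i j : ℕ, i + j ≤ d ∧
      ∃ μ ∈ interpConditions (N₁.proj i), ∃ ν ∈ interpConditions (N₂.proj j), IsTensor μ ν l}

lemma productConditions_mono (N₁ : NewtonSequence K₁) (N₂ : NewtonSequence K₂) :
    Monotone (productConditions N₁ N₂) := fun _ _ hde =>
  Submodule.span_mono fun _ ⟨i, j, hij, h⟩ => ⟨i, j, hij.trans hde, h⟩

/-- Existence of the projectors of the Newton product. -/
lemma exists_product_projector (hK₁ : IsFat K₁) (hK₂ : IsFat K₂) (h₁ : PolyDense K₁)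
    (h₂ : PolyDense K₂) (h : PolyDense (prodCompacts K₁ K₂)) (N₁ : NewtonSequence K₁)
    (N₂ : NewtonSequence K₂) (d : ℕ) :
    ∃ P : CInfty (prodCompacts K₁ K₂) →L[ℝ] CInfty (prodCompacts K₁ K₂),
      (∀ f g, P (smoothMul f g) =
        ∑ k ∈ Finset.range (d + 1), smoothMul (N₁.increment k f) (N₂.proj (d - k) g)) ∧
      IsPolynomialProjector d P ∧ interpConditions P = productConditions N₁ N₂ d := by
  have hK := hK₁.prodCompacts hK₂
  have hex := fun k : ℕ => exists_tensor_operator hK₁ hK₂ h₁ h₂ (N₁.increment_mem_polySub hK₁ k)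
    (fun f => (isPolyOfDegreeLE_iff_mem hK₂).1 ((N₂.isProjector (d - k)).1 f))
  choose T hT hTpoly hTspan using hex
  let P := ∑ k ∈ Finset.range (d + 1), T k
  have hP : ∀ F, P F = ∑ k ∈ Finset.range (d + 1), T k F := fun F => by
    simp only [P, sum_apply]
  have hmul : ∀ f g, P (smoothMul f g) =
      ∑ k ∈ Finset.range (d + 1), smoothMul (N₁.increment k f) (N₂.proj (d - k) g) := fun f g => by
    simp only [hP, hT]
  refine ⟨P, hmul, ⟨fun F => ?_, fun F hF => ?_⟩, le_antisymm ?_ ?_⟩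
  · rw [isPolyOfDegreeLE_iff_mem hK, hP]
    refine Submodule.sum_mem _ fun k hk => ?_
    have hkd : k + (d - k) = d := by have := Finset.mem_range.1 hk; omega
    have := hTpoly k F
    rwa [hkd] at this
  · obtain ⟨r, hr, rfl⟩ := (isPolyOfDegreeLE_iff hK).1 hF
    rw [r.as_sum]
    simp only [map_sum]
    refine Finset.sum_congr rfl fun m hm => ?_
    -- It is enough to reproduce monomials, which split into factors whose degrees add up to at most
    -- `d`.
    rw [monomial_eq_polyMul, polyC_polyMul, hmul]
    set a := (m.comapDomain Sum.inl Sum.inl_injective.injOn).sum fun _ e => e with ha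
    set b := (m.comapDomain Sum.inr Sum.inr_injective.injOn).sum fun _ e => e with hb
    have hab : a + b ≤ d := by
      refine le_trans (le_of_eq ?_) ((MvPolynomial.le_totalDegree hm).trans hr)
      rw [ha, hb, Finsupp.sum_fintype _ _ (by simp), Finsupp.sum_fintype _ _ (by simp),
        Finsupp.sum_fintype _ _ (by simp), Fintype.sum_sum_type]
      rfl
    refine sum_bilin_eq smoothMul (U := fun n => N₂.proj n (polyC K₂ _)) hab
      (fun k hk => N₁.increment_polyC_eq_zero hk (MvPolynomial.totalDegree_monomial_le _ _))
      ?_ (fun n hn => (N₂.isProjector n).apply_polyC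
        ((MvPolynomial.totalDegree_monomial_le _ _).trans hn))
    rw [N₁.sum_increment]
    exact (N₁.isProjector a).apply_polyC (MvPolynomial.totalDegree_monomial_le _ _)
  · intro l hl
    have e : l = ∑ k ∈ Finset.range (d + 1), l.comp (T k) := by
      ext F
      rw [hl F, hP, map_sum, sum_apply]
      rfl
    rw [e]
    refine Submodule.sum_mem _ fun k hk => Submodule.span_mono ?_ (hTspan k l)
    rintro l' ⟨μ, hμ, ν, hν, hl'⟩
    refine ⟨k, d - k, by have := Finset.mem_range.1 hk; omega, μ, fun f => ?_, ν, fun g => ?_, hl'⟩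
    -- The coordinate forms factor through the increment, which absorbs the projector of degree `k`;
    -- so they are conditions of that projector.
    · exact hμ _ _ (N₁.increment_proj k f).symm
    · exact hν _ _ ((N₂.isProjector _).idem g).symm
  · refine Submodule.span_le.2 ?_
    rintro l ⟨i, j, hij, μ, hμ, ν, hν, hl⟩
    rw [isTensor_iff hK₁ hK₂] at hl
    have e : l = l.comp P := by
      refine h.ext_smoothMul fun f g => ?_
      rw [ContinuousLinearMap.comp_apply, hmul, map_sum]
      simp only [hl]
      -- The summation that reproduces polynomials, now for the numbers `μ` and `ν` produce.
      refine (sum_bilin_eq (LinearMap.mul ℝ ℝ) (S := fun k => μ (N₁.increment k f))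
        (U := fun n => ν (N₂.proj n g)) hij (fun k hk => N₁.form_increment_eq_zero hk hμ f) ?_
        (fun n hn => (N₂.interpConditions_mono hn hν g).symm)).symm
      rw [← map_sum, N₁.sum_increment]
      exact (hμ f).symm
    exact fun F => DFunLike.congr_fun e F

/-- Polynomial growth of the projectors of the Newton product on polynomials. -/
lemma exists_product_bound (h₁ : PolyDense K₁) (h₂ : PolyDense K₂)
    (h : PolyDense (prodCompacts K₁ K₂)) {M : ℝ} {k : ℕ} (hM : 0 ≤ M)
    (hMarkov₁ : MarkovBound K₁ M k) (hMarkov₂ : MarkovBound K₂ M k) {N₁ : NewtonSequence K₁}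
    {N₂ : NewtonSequence K₂} (hN₁ : N₁.Converging) (hN₂ : N₂.Converging)
    {P : ℕ → CInfty (prodCompacts K₁ K₂) →L[ℝ] CInfty (prodCompacts K₁ K₂)}
    (hP : ∀ d f g, P d (smoothMul f g) =
      ∑ k ∈ Finset.range (d + 1), smoothMul (N₁.increment k f) (N₂.proj (d - k) g)) :
    ∃ (C : ℝ) (A : ℕ), 0 ≤ C ∧ ∀ d e, d ≤ e → 1 ≤ e → ∀ r : MvPolynomial (ι₁ ⊕ ι₂) ℝ,
      r.totalDegree ≤ e →
      ‖toFn (P d (polyC _ r))‖ ≤ C * (e : ℝ) ^ A * ‖polyOn (prodCompacts K₁ K₂) r‖ := by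
  obtain ⟨C₁, A₁, hC₁, hb₁⟩ :=
    hMarkov₁.exists_uniform_bound hM N₁.increment hN₁.exists_bound_increment
  obtain ⟨C₂, A₂, hC₂, hb₂⟩ := hMarkov₂.exists_uniform_bound hM N₂.proj hN₂.exists_bound
  -- The factor `2` and the extra power of `e` pay for the `d + 1 ≤ 2 * e` summands.
  refine ⟨2 * C₁ * C₂, 1 + A₁ + A₂, by positivity, fun d e hde he r hr => ?_⟩
  refine (ContinuousMap.norm_le _ (by positivity)).2 fun z => ?_
  -- Evaluation at a fixed point turns the tensor products of operators into tensor products of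
  -- forms, with bounds independent of the point.
  let μ : ℕ → CInfty K₁ →L[ℝ] ℝ := fun k => (evalDeriv [] (fstPt z)).comp (N₁.increment k)
  let ν : ℕ → CInfty K₂ →L[ℝ] ℝ := fun k => (evalDeriv [] (sndPt z)).comp (N₂.proj (d - k))
  choose L hL using fun k => exists_tensor h₁ h₂ (μ k) (ν k)
  have e1 : (evalDeriv [] z).comp (P d) = ∑ k ∈ Finset.range (d + 1), L k := by
    refine h.ext_smoothMul fun f g => ?_
    rw [ContinuousLinearMap.comp_apply, hP, map_sum, sum_apply]
    refine Finset.sum_congr rfl fun k _ => ?_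
    rw [hL]
    rfl
  have e2 : toFn (P d (polyC _ r)) z = ∑ k ∈ Finset.range (d + 1), L k (polyC _ r) := by
    rw [← sum_apply, ← e1]
    rfl
  have hLk : ∀ k, |L k (polyC _ r)| ≤
      C₁ * (e : ℝ) ^ A₁ * (C₂ * (e : ℝ) ^ A₂) * ‖polyOn (prodCompacts K₁ K₂) r‖ := fun k =>
    abs_tensor_polyC_le (hL k) (by positivity) (by positivity)
      (fun p hp => (ContinuousMap.norm_coe_le_norm _ _).trans (hb₁ k e he p hp))
      (fun p hp => (ContinuousMap.norm_coe_le_norm _ _).trans (hb₂ (d - k) e he p hp)) hr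
  rw [e2, Real.norm_eq_abs]
  refine (Finset.abs_sum_le_sum_abs _ _).trans ((Finset.sum_le_sum fun k _ => hLk k).trans ?_)
  rw [Finset.sum_const, Finset.card_range, nsmul_eq_mul]
  have hd : ((d + 1 : ℕ) : ℝ) ≤ 2 * e := by
    have : d + 1 ≤ 2 * e := by omega
    exact_mod_cast this
  calc _ ≤ (2 * e : ℝ) *
        (C₁ * (e : ℝ) ^ A₁ * (C₂ * (e : ℝ) ^ A₂) * ‖polyOn (prodCompacts K₁ K₂) r‖) := by
        gcongr
    _ = _ := by ring

end Product

/-! ### Convergence from polynomial growth. -/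

section Convergence

variable {ι : Type*} [Fintype ι] [DecidableEq ι] {K : Compacts (ι → ℝ)}

/-- Projectors that grow polynomially on polynomials converge. -/
lemma tendsto_projectors (hK : IsFat K) (hJ : IsJackson K) {M : ℝ} {k : ℕ} (hM : 0 ≤ M)
    (hMarkov : MarkovBound K M k) {P : ℕ → CInfty K →L[ℝ] CInfty K}
    (hP : ∀ d, IsPolynomialProjector d (P d)) {C : ℝ} {A : ℕ} (hC : 0 ≤ C)
    (hb : ∀ d e, d ≤ e → 1 ≤ e → ∀ r : MvPolynomial ι ℝ, r.totalDegree ≤ e →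
      ‖toFn (P d (polyC K r))‖ ≤ C * (e : ℝ) ^ A * ‖polyOn K r‖) (f : CInfty K) :
    Tendsto (fun d => P d f) atTop (𝓝 f) := by
  obtain ⟨Q, hQ, hQf⟩ := hJ.exists_rapid_approx f
  have hQlim := tendsto_polyC_of_rapid_approx hK hM hMarkov hQ hQf
  refine tendsto_cInfty_iff.2 fun w => ?_
  -- The weight anticipates both losses: `k * w.length` from Markov's inequality and `A` from the
  -- growth of the projectors.
  obtain ⟨B, hB, hinc⟩ := exists_increment_bound hQf (k * w.length + A)
  have hbound : ∀ d e, d ≤ e → 1 ≤ e → ∀ r : MvPolynomial ι ℝ, r.totalDegree ≤ e →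
      ‖derivL K w (P d (polyC K r) - polyC K r)‖ ≤
        M ^ w.length * (C + 1) * ((e : ℝ) ^ (k * w.length + A) * ‖polyOn K r‖) := by
    intro d e hde he r hr
    obtain ⟨s, hs, hs'⟩ := (isPolyOfDegreeLE_iff hK).1 ((hP d).1 (polyC K r))
    have he' : (1 : ℝ) ≤ e := by exact_mod_cast he
    have h1 : ‖polyOn K (s - r)‖ ≤ (C + 1) * (e : ℝ) ^ A * ‖polyOn K r‖ := by
      rw [← polyOnₗ_apply, map_sub]
      refine (norm_sub_le _ _).trans ?_
      have h2 := hb d e hde he r hr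
      rw [hs', toFn_polyC] at h2
      have h3 : ‖polyOn K r‖ ≤ (e : ℝ) ^ A * ‖polyOn K r‖ :=
        le_mul_of_one_le_left (norm_nonneg _) (one_le_pow₀ he')
      simp only [polyOnₗ_apply]
      linarith
    rw [hs', ← map_sub]
    have hdeg : (s - r).totalDegree ≤ e :=
      (MvPolynomial.totalDegree_sub _ _).trans (max_le (hs.trans hde) hr)
    refine (hMarkov.polyDeriv_le hM he hdeg w).trans ?_
    calc _ ≤ M ^ w.length * (e : ℝ) ^ (k * w.length) *
          ((C + 1) * (e : ℝ) ^ A * ‖polyOn K r‖) := by gcongr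
      _ = _ := by rw [pow_add]; ring
  have hmain : ∀ d : ℕ, 1 ≤ d →
      ‖(P d f).1 (word w) - f.1 (word w)‖ ≤ M ^ w.length * (C + 1) * B * (d : ℝ)⁻¹ := by
    intro d hd
    let R : CInfty K →L[ℝ] C(K, ℝ) := (derivL K w).comp (P d - ContinuousLinearMap.id ℝ _)
    have hR : ∀ g, R g = derivL K w (P d g - g) := fun g => rfl
    have hlim : Tendsto (fun n => ‖R (polyC K (Q n))‖) atTop (𝓝 ‖R f‖) :=
      ((R.continuous.tendsto f).comp hQlim).norm
    refine le_of_tendsto hlim ?_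
    filter_upwards [eventually_ge_atTop d] with n hn
    -- Since the error operator kills `Q d`, the telescoping sum starts at `d`, which yields the
    -- factor `1 / d`.
    have h0 : R (polyC K (Q d)) = 0 := by
      rw [hR, (hP d).apply_polyC (hQ d), sub_self, map_zero]
    have := norm_sub_le_of_increments (u := fun n => R (polyC K (Q n)))
      (B := M ^ w.length * (C + 1) * B) (by positivity) (fun m hm => ?_) hn
    · simpa only [h0, sub_zero] using this
    · have hdeg : (Q (m + 1) - Q m).totalDegree ≤ m + 1 :=
        (MvPolynomial.totalDegree_sub _ _).trans
          (max_le (hQ (m + 1)) ((hQ m).trans (Nat.le_succ m)))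
      rw [← map_sub, ← map_sub, hR, mul_assoc _ B]
      exact (hbound d (m + 1) (by omega) (by omega) _ hdeg).trans
        (mul_le_mul_of_nonneg_left (hinc m (hd.trans hm)) (by positivity))
  rw [tendsto_iff_norm_sub_tendsto_zero]
  have hlim : Tendsto (fun d : ℕ => M ^ w.length * (C + 1) * B * (d : ℝ)⁻¹) atTop (𝓝 0) := by
    simpa using (tendsto_inv_atTop_nhds_zero_nat (𝕜 := ℝ)).const_mul (M ^ w.length * (C + 1) * B)
  refine squeeze_zero' (Eventually.of_forall fun n => norm_nonneg _) ?_ hlim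
  filter_upwards [eventually_ge_atTop 1] with d hd using hmain d hd

lemma NewtonSequence.eq_of_proj {N N' : NewtonSequence K} (h : ∀ d, N.proj d = N'.proj d) :
    N = N' := by
  obtain ⟨p, _, _⟩ := N
  obtain ⟨p', _, _⟩ := N'
  obtain rfl : p = p' := funext h
  rfl

end Convergence

/-! ### Assembly of existence, uniqueness and convergence. -/

section Main

variable {ι₁ ι₂ : Type*} [Fintype ι₁] [DecidableEq ι₁] [Fintype ι₂] [DecidableEq ι₂]
  {K₁ : Compacts (ι₁ → ℝ)} {K₂ : Compacts (ι₂ → ℝ)}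

/-- Existence, uniqueness and convergence of the Newton product. -/
theorem exists_unique_converging_newtonProduct (hK₁ : IsFat K₁) (hK₂ : IsFat K₂) {r₁ r₂ : ℝ}
    (hMarkov₁ : SatisfiesMarkov K₁ r₁) (hMarkov₂ : SatisfiesMarkov K₂ r₂)
    (hJ : IsJackson (prodCompacts K₁ K₂)) {N₁ : NewtonSequence K₁} {N₂ : NewtonSequence K₂}
    (hN₁ : N₁.Converging) (hN₂ : N₂.Converging) :
    ∃ N : NewtonSequence (prodCompacts K₁ K₂), IsNewtonProduct N₁ N₂ N ∧
      (∀ N' : NewtonSequence (prodCompacts K₁ K₂), IsNewtonProduct N₁ N₂ N' → N' = N) ∧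
      N.Converging := by
  obtain ⟨M₁, k₁, hM₁, hm₁⟩ := hMarkov₁.exists_markovBound
  obtain ⟨M₂, k₂, hM₂, hm₂⟩ := hMarkov₂.exists_markovBound
  have hM : 0 ≤ max M₁ M₂ := hM₁.trans (le_max_left _ _)
  replace hm₁ := hm₁.mono (le_max_left M₁ M₂) hM (le_max_left k₁ k₂)
  replace hm₂ := hm₂.mono (le_max_right M₁ M₂) hM (le_max_right k₁ k₂)
  have hm := MarkovBound.prodCompacts hM hm₁ hm₂
  have hK := hK₁.prodCompacts hK₂
  have h₁ := hN₁.polyDense hK₁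
  have h₂ := hN₂.polyDense hK₂
  have h := hJ.polyDense hK hM hm
  choose P hmul hproj hcond using exists_product_projector hK₁ hK₂ h₁ h₂ h N₁ N₂
  obtain ⟨C, A, hC, hb⟩ := exists_product_bound h₁ h₂ h hM hm₁ hm₂ hN₁ hN₂ hmul
  refine ⟨⟨P, hproj, fun d => ?_⟩, hcond, fun N' hN' => ?_,
    tendsto_projectors hK hJ hM hm hproj hC hb⟩
  · rw [hcond, hcond]
    exact productConditions_mono N₁ N₂ (Nat.le_succ d)
  · refine NewtonSequence.eq_of_proj fun d => ?_
    exact (N'.isProjector d).eq_of_interpConditions (hproj d)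
      ((hN' d).trans (hcond d).symm).le

end Main

end NewtonProduct

end

theorem mainTheorem12 (n₁ n₂ : ℕ)
    (K₁ : TopologicalSpace.Compacts (Fin n₁ → ℝ)) (K₂ : TopologicalSpace.Compacts (Fin n₂ → ℝ))
    (hfat₁ : NewtonProduct.IsFat K₁) (hfat₂ : NewtonProduct.IsFat K₂)
    (θ₁ θ₂ r₁ r₂ : ℝ)
    (hSBM₁ : NewtonProduct.IsSBM K₁ θ₁) (hSBM₂ : NewtonProduct.IsSBM K₂ θ₂)
    (hMarkov₁ : NewtonProduct.SatisfiesMarkov K₁ r₁)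
    (hMarkov₂ : NewtonProduct.SatisfiesMarkov K₂ r₂)
    (hJackson : NewtonProduct.IsJackson (NewtonProduct.prodCompacts K₁ K₂))
    (N₁ : NewtonProduct.NewtonSequence K₁) (N₂ : NewtonProduct.NewtonSequence K₂)
    (hN₁ : N₁.Converging) (hN₂ : N₂.Converging) :
    ∃ N : NewtonProduct.NewtonSequence (NewtonProduct.prodCompacts K₁ K₂),
      NewtonProduct.IsNewtonProduct N₁ N₂ N ∧
      (∀ N' : NewtonProduct.NewtonSequence (NewtonProduct.prodCompacts K₁ K₂),
        NewtonProduct.IsNewtonProduct N₁ N₂ N' → N' = N) ∧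
      N.Converging :=
  NewtonProduct.exists_unique_converging_newtonProduct hfat₁ hfat₂ hMarkov₁ hMarkov₂
    hJackson hN₁ hN₂
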